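/- **Setting.** Let $d\ge 1$ and let $p$ be a bounded probability density on $\mathbb{R}^d$ with induced measure $\mu$; $X_1,\dots,X_n$ are i.i.d. with law $\mu$. For $t>0$ let $L(t)=\overline{\{p\ge t\}}$. Assume that $L(t)$ has finitely many ($m\ge 1$) connected components $C^{(1)},\dots,C^{(m)}$ (the clusters), each compact with boundary a $C^2$ hypersurface. Let $\kappa^{(i)}$ be the minimal curvature radius of $\partial C^{(i)}$ in its global form: the largest $r$ such that each boundary point is touched from inside by a closed ball of radius $r$ contained in $C^{(i)}$; assume $\kappa^{(i)}>0$. Let $Col^{(i)}(\nu)=\{x\in C^{(i)}: \mathrm{dist}(x,\partial C^{(i)})\le\nu\}$, $\nu^{(i)}_{\max}=\sup\{\nu\in[0,\kappa^{(i)}]: C^{(i)}\setminus Col^{(i)}(\nu)\text{ non-empty and connected}\}$, $p^{(i)}_{\max}=\sup_{C^{(i)}}p$, $p_{\max}=\max_i p^{(i)}_{\max}$, $\eta_d$ the volume of the unit ball, and let $C_-^{(i)}(s)$ be the component of $L(t-s)$ containing $C^{(i)}$. *Noise-free case:* a.e., $p\ge t$ on $L(t)$ and $p=0$ outside $L(t)$;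 put $E^{(i)}=C^{(i)}$. *Noisy case:* $\tilde\varepsilon>0$ is fixed and $E^{(i)}=C_-^{(i)}(2\tilde\varepsilon)$. In both cases $u^{(i)}>0$ and $\rho^{(i)}>0$ are numbers with $\mathrm{dist}(E^{(i)},E^{(j)})\ge u^{(i)}$ for $j\neq i$ and $\rho^{(i)}\le\inf_{x\in E^{(i)}}\mu(B(x,u^{(i)}))$; $\rho_{\min}=\min_i\rho^{(i)}$. $G_{\mathrm{mut}}(n,k)$ joins $X_a,X_b$ if each is among the $k$ nearest neighbours of the other. All clusters are *identified* in it if sample points of the same cluster are always connected by a path and sample points of different clusters never are. $\tilde G_{\mathrm{mut}}(n,k,t',\delta)$ arises from it by deleting the points with $\hat p_n(X_a)<t'$ and then the connected components with fewer than $\delta n$ points, where $\hat p_n(y)=\frac1{nh^d}\sum_jK((y-X_j)/h)$ with $K$ bounded, measurable, even, $\int K=1$, $\int\|x\|^2|K|<\infty$. All clusters are *roughly identified* in it if it contains all sample points of the clusters, sample points of the same cluster are connected in it, and each of its connected components contains points of exactly one cluster (and possibly background points). *Condition 1 (for $i,n,k$):* $k\ge 4^{d+1}\frac{p^{(i)}_{\max}}{t}\log\big(2\cdot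 8^d p^{(i)}_{\max}\mathrm{vol}(C^{(i)})\,n\big)$ and $k\le (n-1)\min\big\{\frac{\rho^{(i)}}2-\frac{2\log(\mu(E^{(i)})n)}{n-1},\ 2\cdot4^d\eta_d\,p^{(i)}_{\max}\min\{u^{(i)},\nu^{(i)}_{\max}\}^d\big\}$. *Condition 2 (for $\varepsilon,\delta$):* $p$ is three times continuously differentiable with uniformly bounded derivatives, $\mu(C^{(i)})>2\delta$ for all $i$, and $\mu\big(\bigcup_i(C_-^{(i)}(2\varepsilon)\setminus C^{(i)})\big)\le\delta/2$. **Theorem.** Put $k^*=(n-1)\dfrac{\rho_{\min}}{2+\frac1{4^d}\frac t{p_{\max}}}+1$, $\Omega=\dfrac{\rho_{\min}}{2\cdot4^{d+1}\frac{p_{\max}}t+4}$, $a_n(k)=\frac{n-1}2\big(\frac{\rho_{\min}}2-\frac{k-1}{n-1}\big)$, $b(k)=\frac{k-1}{4^{d+1}}\frac t{p_{\max}}$. (1) *Noise-free case.* For all sufficiently large $n$: (a) for every integer $k$ satisfying Condition 1 for all clusters, all clusters are identified in $G_{\mathrm{mut}}(n,k)$ with probability at least $1-m e^{-a_n(k)}-2m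 e^{-b(k)}$; (b) $k=k^*$ is optimal for this guarantee: it is the unique maximizer over real $k$ of the exponent $\min\{a_n(k),b(k)\}$, and the maximum is $(n-1)\Omega$; (c) if $k$ is $k^*$ rounded to an integer (any integer $k$ with $|k-k^*|<1$) and fulfils Condition 1 for all clusters, then all clusters are identified in $G_{\mathrm{mut}}(n,k)$ with probability at least $1-3m\,e^{-(n-1)\Omega}$. (2) *Noisy case.* Let $p$ be three times continuously differentiable with uniformly bounded derivatives. There are constants $C_1,C_2>0$ depending only on $p$ and $K$ such that the following holds for all $t$, clusters, $u^{(i)},\rho^{(i)},\tilde\varepsilon$ as above, all $0<\varepsilon\le\tilde\varepsilon$ such that each connected component of $L(t-2\varepsilon)$ contains a cluster, all $\delta>0$ with Condition 2, and all $h>0$ with $h^2\le C_1\varepsilon$. For all sufficiently large $n$, with $$\Omega_{\mathrm{noisy}}=\min\Big\{\Omega,\ \tfrac n{n-1}\tfrac\delta8,\ \tfrac n{n-1}C_2h^d\varepsilon^2\Big\}:$$ (a) for every integer $k$ satisfying Condition 1 for all clusters, all clusters are roughly identified in $\tilde G_{\mathrm{mut}}(n,k,t-\varepsilon,\delta)$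 with probability at least $1-m e^{-a_n(k)}-2m e^{-b(k)}-2e^{-n\delta/8}-3e^{-nC_2h^d\varepsilon^2}$; (b) $k=k^*$ maximizes the exponent $\min\{a_n(k),b(k),n\delta/8,nC_2h^d\varepsilon^2\}$ over real $k$, with maximum $(n-1)\Omega_{\mathrm{noisy}}$; (c) for any integer $k$ with $|k-k^*|<1$ that fulfils Condition 1 for all clusters, all clusters are roughly identified in $\tilde G_{\mathrm{mut}}(n,k,t-\varepsilon,\delta)$ with probability at least $1-(3m+5)e^{-(n-1)\Omega_{\mathrm{noisy}}}$. -/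

import Mathlib

open MeasureTheory Set Metric

noncomputable section

namespace KNNCluster

/-- The Euclidean space `ℝ^d`. -/
abbrev Pt (d : ℕ) : Type := EuclideanSpace ℝ (Fin d)

/-! ### Densities, level sets and clusters -/

/-- `p` is a bounded probability density with respect to Lebesgue measure on `ℝ^d`. -/
structure IsBoundedDensity {d : ℕ} (p : Pt d → ℝ) : Prop where
  measurable : Measurable p
  nonneg : ∀ x, 0 ≤ p x
  bounded : ∃ M : ℝ, ∀ x, p x ≤ M
  lintegral_eq_one : ∫⁻ x, ENNReal.ofReal (p x) = 1

/-- The measure on `ℝ^d` with density `p`. -/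
def law {d : ℕ} (p : Pt d → ℝ) : Measure (Pt d) :=
  (volume : Measure (Pt d)).withDensity fun x => ENNReal.ofReal (p x)

/-- The joint law of `n` independent sample points with density `p`. -/
def sampleLaw {d : ℕ} (p : Pt d → ℝ) (n : ℕ) : Measure (Fin n → Pt d) :=
  Measure.pi fun _ => law p

/-- The `t`-level set of `p`: the closure of `{p ≥ t}`. -/
def levelSet {d : ℕ} (p : Pt d → ℝ) (t : ℝ) : Set (Pt d) :=
  closure {x | t ≤ p x}

/-- `A` is a `(d-1)`-dimensional submanifold of `ℝ^d` of class `C^2`: locally it is the zero set of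
a `C^2` function with nonvanishing derivative. -/
def IsC2Hypersurface {d : ℕ} (A : Set (Pt d)) : Prop :=
  ∀ x ∈ A, ∃ (U : Set (Pt d)) (f : Pt d → ℝ), IsOpen U ∧ x ∈ U ∧ ContDiffOn ℝ 2 f U ∧
    (∀ y ∈ U, fderiv ℝ f y ≠ 0) ∧ A ∩ U = {y ∈ U | f y = 0}

/-- The minimal curvature radius of the boundary of `C`, in its global (rolling ball) form:
the largest `r` such that every boundary point of `C` is touched from inside by a closed ball of
radius `r` that does not stick out of `C`. -/
def curvatureRadius {d : ℕ} (C : Set (Pt d)) : ℝ :=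
  sSup {r | 0 ≤ r ∧ ∀ x ∈ frontier C, ∃ y, dist x y = r ∧ closedBall y r ⊆ C}

/-- The collar set: the points of `C` at distance at most `ν` from the boundary of `C`. -/
def collar {d : ℕ} (C : Set (Pt d)) (ν : ℝ) : Set (Pt d) :=
  {x ∈ C | infDist x (frontier C) ≤ ν}

/-- The maximal covering radius of `C`. -/
def coveringRadius {d : ℕ} (C : Set (Pt d)) : ℝ :=
  sSup {ν | 0 ≤ ν ∧ ν ≤ curvatureRadius C ∧ IsConnected (C \ collar C ν)}

/-- `C 0, …, C (m-1)` is the list, without repetition, of the connected components of the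
`t`-level set of `p`, and each of them is compact with a regular boundary. -/
structure IsClusters {d m : ℕ} (p : Pt d → ℝ) (t : ℝ) (C : Fin m → Set (Pt d)) : Prop where
  injective : Function.Injective C
  range_eq : range C = {A | ∃ x ∈ levelSet p t, A = connectedComponentIn (levelSet p t) x}
  isCompact : ∀ i, IsCompact (C i)
  boundary : ∀ i, IsC2Hypersurface (frontier (C i))
  curvatureRadius_pos : ∀ i, 0 < curvatureRadius (C i)

/-- `C_-(s)`: for a cluster `C` at level `t`, the connected component of `L(t - s)`
containing `C`. -/
def enlarge {d : ℕ} (p : Pt d → ℝ) (t s : ℝ) (C : Set (Pt d)) : Set (Pt d) :=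
  ⋃ x ∈ C, connectedComponentIn (levelSet p (t - s)) x

/-- For the (possibly enlarged) clusters `E i`, the number `u i > 0` is a lower bound on the
distance of `E i` to the other ones, and `ρ i > 0` is a lower bound on the probability mass
of balls of radius `u i` around points of `E i`. -/
structure IsSeparated {d m : ℕ} (p : Pt d → ℝ) (E : Fin m → Set (Pt d)) (u ρ : Fin m → ℝ) :
    Prop where
  u_pos : ∀ i, 0 < u i
  le_dist : ∀ i j, i ≠ j → ∀ x ∈ E i, ∀ y ∈ E j, u i ≤ dist x y
  rho_pos : ∀ i, 0 < ρ i
  le_mass : ∀ i, ∀ x ∈ E i, ρ i ≤ (law p).real (ball x (u i))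

/-- The noise-free case: up to Lebesgue null sets, `p` vanishes outside of the clusters and
is at least `t` on them. -/
def IsNoiseFree {d : ℕ} (p : Pt d → ℝ) (t : ℝ) : Prop :=
  ∀ᵐ x, (x ∈ levelSet p t → t ≤ p x) ∧ (x ∉ levelSet p t → p x = 0)

/-- The maximal density in a cluster. -/
def maxDensity {d : ℕ} (p : Pt d → ℝ) (C : Set (Pt d)) : ℝ := sSup (p '' C)

/-! ### Neighborhood graphs -/

/-- The (indices of the) `k` nearest neighbors of the sample point `x j` among the other sample
points: those `i ≠ j` such that fewer than `k` of the other points are strictly closer to `x j`.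
(For a sample from a density there are almost surely no ties.) -/
def kNN {d n : ℕ} (k : ℕ) (x : Fin n → Pt d) (j : Fin n) : Set (Fin n) :=
  {i | i ≠ j ∧ {l | l ≠ j ∧ dist (x l) (x j) < dist (x i) (x j)}.ncard < k}

/-- The mutual `k`-nearest-neighbor graph. -/
def mutualKNN {d n : ℕ} (k : ℕ) (x : Fin n → Pt d) : SimpleGraph (Fin n) where
  Adj i j := i ∈ kNN k x j ∧ j ∈ kNN k x i
  symm := ⟨fun _ _ h => ⟨h.2, h.1⟩⟩
  loopless := ⟨fun _ h => h.1.1 rfl⟩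

/-- The kernel density estimate at `y` with kernel `K` and bandwidth `h`. -/
def kde {d n : ℕ} (K : Pt d → ℝ) (h : ℝ) (x : Fin n → Pt d) (y : Pt d) : ℝ :=
  1 / (n * h ^ d) * ∑ j, K (h⁻¹ • (y - x j))

/-- A standard (bounded, symmetric, second order) kernel. -/
structure IsKernel {d : ℕ} (K : Pt d → ℝ) : Prop where
  measurable : Measurable K
  bounded : ∃ M : ℝ, ∀ x, |K x| ≤ M
  integrable : Integrable K
  integral_eq_one : ∫ x, K x = 1
  even : ∀ x, K (-x) = K x
  second_moment : Integrable fun x => ‖x‖ ^ 2 * K x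

/-- The vertices kept in the first step: those at which the density estimate `q` is at least
the threshold `t'`. The induced subgraph is `G'`. -/
def denseVertices {n : ℕ} (q : Fin n → ℝ) (t' : ℝ) : Set (Fin n) := {a | t' ≤ q a}

/-- The vertices of `S` whose connected component in the subgraph of `G` induced by `S` has at
least `s` vertices. -/
def largeVertices {n : ℕ} (G : SimpleGraph (Fin n)) (S : Set (Fin n)) (s : ℝ) : Set (Fin n) :=
  {a | ∃ ha : a ∈ S, s ≤ ({b : S | (G.induce S).Reachable ⟨a, ha⟩ b}.ncard : ℝ)}

/-- The vertex set of `G̃_mut(n, k, t', δ)`: remove the points whose estimated density is less than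
`t'`, then the connected components of the remaining graph with less than `δ n` points.
The graph `G̃_mut(n, k, t', δ)` is the subgraph of the mutual `k`-nearest-neighbor graph that is
induced by this set. -/
def tildeVertices {d n : ℕ} (K : Pt d → ℝ) (h : ℝ) (k : ℕ) (t' δ : ℝ) (x : Fin n → Pt d) :
    Set (Fin n) :=
  largeVertices (mutualKNN k x) (denseVertices (fun a => kde K h x (x a)) t') (δ * n)

/-! ### Identification of clusters -/

/-- Cluster `C i` is identified in the graph `G` on the sample `x`: its sample points are
connected to each other, and not connected to sample points of any other cluster. -/
def IsIdentified {d m n : ℕ} (C : Fin m → Set (Pt d)) (x : Fin n → Pt d)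
    (G : SimpleGraph (Fin n)) (i : Fin m) : Prop :=
  (∀ a b, x a ∈ C i → x b ∈ C i → G.Reachable a b) ∧
  ∀ j, j ≠ i → ∀ a b, x a ∈ C i → x b ∈ C j → ¬ G.Reachable a b

/-- Cluster `C i` is roughly identified in the subgraph of `G` induced by `V`: all its sample points
belong to `V`, they are connected to each other in the subgraph, and every connected component of
the subgraph contains points of exactly one cluster (and maybe additional noise points). -/
def IsRoughlyIdentified {d m n : ℕ} (C : Fin m → Set (Pt d)) (x : Fin n → Pt d)
    (G : SimpleGraph (Fin n)) (V : Set (Fin n)) (i : Fin m) : Prop :=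
  (∀ a, x a ∈ C i → a ∈ V) ∧
  (∀ a b : V, x a ∈ C i → x b ∈ C i → (G.induce V).Reachable a b) ∧
  ∀ c : (G.induce V).ConnectedComponent, ∃! j : Fin m, ∃ a ∈ c.supp, x a ∈ C j

/-! ### Conditions, optimal parameter and rates -/

/-- The volume of the unit ball of `ℝ^d`. -/
def unitBallVolume (d : ℕ) : ℝ := (volume : Measure (Pt d)).real (ball 0 1)

/-- Lower and upper bounds on the number `k` of neighbors, for one cluster `C` with enlarged
cluster `E` and constants `u` and `ρ`. -/
def Condition1 {d : ℕ} (p : Pt d → ℝ) (t : ℝ) (C E : Set (Pt d)) (u ρ : ℝ) (n k : ℕ) : Prop :=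
  4 ^ (d + 1) * (maxDensity p C / t) *
      Real.log (2 * 8 ^ d * maxDensity p C * (volume : Measure (Pt d)).real C * n) ≤ k ∧
  (k : ℝ) ≤ ((n : ℝ) - 1) *
    min (ρ / 2 - 2 * Real.log ((law p).real E * n) / ((n : ℝ) - 1))
      (2 * 4 ^ d * unitBallVolume d * maxDensity p C * min (u ^ d) (coveringRadius C ^ d))

/-- The density is three times continuously differentiable with bounded derivatives. -/
def IsC3Bounded {d : ℕ} (p : Pt d → ℝ) : Prop :=
  ContDiff ℝ 3 p ∧ ∃ M : ℝ, ∀ j : ℕ, j ≤ 3 → ∀ x, ‖iteratedFDeriv ℝ j p x‖ ≤ M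

/-- Background mass and cluster mass compared with `δ`. -/
def Condition2 {d m : ℕ} (p : Pt d → ℝ) (t : ℝ) (C : Fin m → Set (Pt d)) (ε δ : ℝ) : Prop :=
  (∀ i, 2 * δ < (law p).real (C i)) ∧
  (law p).real (⋃ i, enlarge p t (2 * ε) (C i) \ C i) ≤ δ / 2

/-- The number of neighbors `(n - 1) Γ + 1` with `Γ = ρ / (2 + t / (4^d p_max))`. -/
def optimalK (d : ℕ) (ρ pmax t : ℝ) (n : ℕ) : ℝ :=
  ((n : ℝ) - 1) * (ρ / (2 + 1 / 4 ^ d * (t / pmax))) + 1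

/-- The rate in the noise-free case. -/
def rateNoiseFree (d : ℕ) (ρ pmax t : ℝ) : ℝ :=
  ρ / (2 * 4 ^ (d + 1) * (pmax / t) + 4)

/-- The rate in the noisy case. -/
def rateNoisy (d : ℕ) (ρ pmax t δ c h ε : ℝ) (n : ℕ) : ℝ :=
  min (rateNoiseFree d ρ pmax t)
    (min ((n : ℝ) / ((n : ℝ) - 1) * (δ / 8)) ((n : ℝ) / ((n : ℝ) - 1) * (c * h ^ d * ε ^ 2)))

/-- The exponent of the bound for between-cluster connections. -/
def isolationExponent (ρ : ℝ) (n : ℕ) (k : ℝ) : ℝ :=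
  ((n : ℝ) - 1) / 2 * (ρ / 2 - (k - 1) / ((n : ℝ) - 1))

/-- The exponent of the bound for within-cluster disconnectedness. -/
def connectionExponent (d : ℕ) (pmax t k : ℝ) : ℝ :=
  (k - 1) / 4 ^ (d + 1) * (t / pmax)

/-- The exponent guaranteed in the noise-free case with `k` neighbors. -/
def exponentNoiseFree (d : ℕ) (ρ pmax t : ℝ) (n : ℕ) (k : ℝ) : ℝ :=
  min (isolationExponent ρ n k) (connectionExponent d pmax t k)

/-- The exponent guaranteed in the noisy case with `k` neighbors. -/
def exponentNoisy (d : ℕ) (ρ pmax t δ c h ε : ℝ) (n : ℕ) (k : ℝ) : ℝ :=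
  min (exponentNoiseFree d ρ pmax t n k) (min (n * (δ / 8)) (n * (c * h ^ d * ε ^ 2)))

end KNNCluster

end

/-!
Two random events decide whether the clusters are identified.

*Connections within a cluster.* For `ν` below the curvature radius, the set of points of a cluster
`C` at distance at least `ν` from the boundary is connected (`isPreconnected_innerSet`), since
the inner normal segments of length `ν` at different boundary points meet only in common inner end
points; this rests on `touching_balls_aligned`, the only place where smoothness of the boundary
enters. By a packing argument the set has a net of few balls of radius `ν` contained in `C`
(`exists_finite_net`). If each of these balls contains a sample point, and sample points of `C` at
distance at most `4 ν` are mutual neighbors, then the sample points of `C` are connected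
(`reachable_of_net`). With `ν` chosen such that a ball of radius `4 ν` contains at most
`(k - 1) / 2` points on average, both requirements hold up to a probability
`exp (-connectionExponent)` (`sampleLaw_not_isLinked_le`).

*Connections between clusters.* If every sample point of an (enlarged) cluster has at least `k`
other points within distance `u`, then all its edges are shorter than `u` and do not
reach any other cluster. A lower tail bound yields `sampleLaw_exists_sparse_le`.

The bounds used here are smaller by a factor `1 / 2` than the stated ones
(`eventually_sampleLaw_not_linked_isolated_le`). This pays for rounding the optimal `k`: both
exponents are affine in `k`, one decreasing with slope `1 / 2`, the other increasing with a smaller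
slope, and they cross at `optimalK`, so rounding costs at most a factor `exp (1 / 2) < 2`.

In the noisy case, the density estimates at all sample points are moreover `ε`-accurate
(`exists_kde_concentration`, from a second order Taylor bound for the bias and a Bernstein type
bound for the deviation), the clusters contain many points and the background few
(`eventually_sampleLaw_counts_le`). Then pruning leaves exactly one cluster in each component
(`isRoughlyIdentified_of_linked_isolated`). The constants may depend on `p` and `K` only because `ε`
is bounded in terms of `p`: a positive lower bound for the mass of balls around points of
the enlarged clusters is impossible when the level `t - 2 * ε₀` is not positive
(`lt_of_isSeparated_enlarge`).
-/

namespace KNNCluster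

open Filter Topology
open scoped RealInnerProductSpace

/-! ### Connectedness of the points of a cluster that are far from its boundary -/

theorem subset_interior_of_disjoint_frontier {X : Type*} [TopologicalSpace X] {C S : Set X}
    (hS : IsPreconnected S) (hd : Disjoint S (frontier C)) (hne : (S ∩ C).Nonempty) :
    S ⊆ interior C := by
  have hcov : S ⊆ interior C ∪ (closure C)ᶜ := by
    intro x hx
    by_contra hcon
    rw [mem_union, not_or, mem_compl_iff, not_not] at hcon
    exact hd.le_bot ⟨hx, hcon.2, hcon.1⟩
  refine hS.subset_left_of_subset_union isOpen_interior isClosed_closure.isOpen_compl ?_ hcov ?_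
  · exact disjoint_compl_right.mono_left (interior_subset.trans subset_closure)
  · obtain ⟨x, hxS, hxC⟩ := hne
    refine ⟨x, hxS, ?_⟩
    rcases hcov hxS with h | h
    · exact h
    · exact absurd (subset_closure hxC) h

theorem ball_subset_interior {E : Type*} [SeminormedAddCommGroup E] [NormedSpace ℝ E] {C : Set E}
    {c : E} {r : ℝ} (h : closedBall c r ⊆ C) : ball c r ⊆ interior C :=
  interior_maximal (ball_subset_closedBall.trans h) isOpen_ball

theorem le_dist_of_mem_frontier {E : Type*} [SeminormedAddCommGroup E] [NormedSpace ℝ E]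
    {C : Set E} {c q : E} {r : ℝ} (h : closedBall c r ⊆ C) (hq : q ∈ frontier C) :
    r ≤ dist q c := by
  by_contra hlt
  exact hq.2 (ball_subset_interior h (mem_ball.2 (not_le.1 hlt)))

theorem eventually_pos_of_fderiv_pos {E : Type*} [NormedAddCommGroup E] [NormedSpace ℝ E]
    {f : E → ℝ} {f' : E →L[ℝ] ℝ} {q a : E} (hf : HasFDerivAt f f' q) (hq : f q = 0)
    (ha : 0 < f' a) : ∀ᶠ s : ℝ in 𝓝[>] 0, 0 < f (q + s • a) := by
  have h1 : HasDerivAt (fun s : ℝ => f (q + s • a)) (f' a) 0 := by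
    have h2 : HasDerivAt (fun s : ℝ => q + s • a) a 0 := by
      simpa using ((hasDerivAt_id (0 : ℝ)).smul_const a).const_add q
    have h3 : HasFDerivAt f f' (q + (0 : ℝ) • a) := by simpa using hf
    exact h3.comp_hasDerivAt 0 h2
  have h4 := h1.tendsto_slope_zero_right
  filter_upwards [h4.eventually (lt_mem_nhds ha), self_mem_nhdsWithin] with s hs hs0
  simp only [zero_add, zero_smul, add_zero, hq, sub_zero, smul_eq_mul] at hs
  exact (mul_pos_iff_of_pos_left (inv_pos.2 hs0)).1 hs

theorem eventually_mem_ball_of_inner_pos {E : Type*} [NormedAddCommGroup E]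
    [InnerProductSpace ℝ E] {c q a : E} (ha : 0 < ⟪c - q, a⟫) :
    ∀ᶠ s : ℝ in 𝓝[>] 0, q + s • a ∈ ball c (dist q c) := by
  have h1 : Tendsto (fun s : ℝ => 2 * ⟪c - q, a⟫ - s * ‖a‖ ^ 2) (𝓝[>] 0)
      (𝓝 (2 * ⟪c - q, a⟫ - 0 * ‖a‖ ^ 2)) :=
    (((continuous_const.sub (continuous_id.mul continuous_const)).tendsto 0)).mono_left
      nhdsWithin_le_nhds
  have h2 : ∀ᶠ s : ℝ in 𝓝[>] 0, 0 < 2 * ⟪c - q, a⟫ - s * ‖a‖ ^ 2 :=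
    h1.eventually (lt_mem_nhds (by linarith))
  filter_upwards [h2, self_mem_nhdsWithin] with s hs hs0
  have hs0' : (0 : ℝ) < s := hs0
  rw [mem_ball, dist_eq_norm, dist_comm, dist_eq_norm]
  refine lt_of_pow_lt_pow_left₀ 2 (norm_nonneg _) ?_
  have : q + s • a - c = s • a - (c - q) := by abel
  rw [this, norm_sub_sq_real, norm_smul, inner_smul_left, real_inner_comm (c - q) a,
    Real.norm_eq_abs, mul_pow, sq_abs]
  simp only [conj_trivial]
  nlinarith [mul_pos hs0' hs]

/-- If a ball inside `C` touches the zero set of `f` at `q` and the zero set is the boundary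
of `C` near `q`, then the ball is tangent to the kernel of the derivative: otherwise `f` would take
both signs, hence also the value zero, inside of the ball. -/
theorem inner_eq_zero_of_touching {E : Type*} [NormedAddCommGroup E]
    [InnerProductSpace ℝ E] {C U : Set E} {f : E → ℝ} {f' : E →L[ℝ] ℝ} {c q : E} {r : ℝ}
    (hU : IsOpen U) (hqU : q ∈ U) (hfc : ContinuousOn f U) (hf : HasFDerivAt f f' q)
    (hq0 : f q = 0) (hf' : f' ≠ 0) (hfr : frontier C ∩ U = {y ∈ U | f y = 0})
    (hball : closedBall c r ⊆ C) (hr : dist q c = r) {w : E} (hw : f' w = 0) :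
    ⟪c - q, w⟫ = 0 := by
  have key : ∀ w : E, f' w = 0 → ¬ 0 < ⟪c - q, w⟫ := by
    intro w hw hpos
    obtain ⟨v, hv⟩ : ∃ v, 0 < f' v := by
      obtain ⟨v, hv⟩ : ∃ v, f' v ≠ 0 := by
        by_contra! hcon
        exact hf' (ContinuousLinearMap.ext hcon)
      rcases lt_or_gt_of_ne hv with h | h
      · exact ⟨-v, by simpa using h⟩
      · exact ⟨v, h⟩
    -- Perturb `w` to both sides of the kernel without leaving the half-space of the ball.
    obtain ⟨e, he0, he1, he2⟩ : ∃ e : ℝ, 0 < e ∧ 0 < ⟪c - q, w + e • v⟫ ∧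
        0 < ⟪c - q, w - e • v⟫ := by
      have h1 : Tendsto (fun e : ℝ => ⟪c - q, w + e • v⟫) (𝓝[>] 0) (𝓝 ⟪c - q, w⟫) := by
        have : Continuous fun e : ℝ => ⟪c - q, w + e • v⟫ := by fun_prop
        simpa using (this.tendsto 0).mono_left nhdsWithin_le_nhds
      have h2 : Tendsto (fun e : ℝ => ⟪c - q, w - e • v⟫) (𝓝[>] 0) (𝓝 ⟪c - q, w⟫) := by
        have : Continuous fun e : ℝ => ⟪c - q, w - e • v⟫ := by fun_prop
        simpa using (this.tendsto 0).mono_left nhdsWithin_le_nhds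
      have h0 : ∀ᶠ e : ℝ in 𝓝[>] 0, 0 < e := self_mem_nhdsWithin
      exact (h0.and ((h1.eventually (lt_mem_nhds hpos)).and
        (h2.eventually (lt_mem_nhds hpos)))).exists
    obtain ⟨δ, hδ, hδU⟩ := Metric.isOpen_iff.1 hU q hqU
    have hn : ∀ a : E, ∀ᶠ s : ℝ in 𝓝[>] 0, q + s • a ∈ ball q δ := by
      intro a
      have : Tendsto (fun s : ℝ => q + s • a) (𝓝[>] 0) (𝓝 q) := by
        have hc : Continuous fun s : ℝ => q + s • a := by fun_prop
        simpa using (hc.tendsto 0).mono_left nhdsWithin_le_nhds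
      exact this.eventually (ball_mem_nhds q hδ)
    have hpa : 0 < f' (w + e • v) := by simp [hw, mul_pos he0 hv]
    have hpb : 0 < (-f') (w - e • v) := by simp [hw, mul_pos he0 hv]
    obtain ⟨s, h1, h2, h3, h4, h5, h6⟩ := ((eventually_pos_of_fderiv_pos hf hq0 hpa).and
      ((eventually_pos_of_fderiv_pos hf.neg (by simp [hq0]) hpb).and
      ((eventually_mem_ball_of_inner_pos he1).and ((eventually_mem_ball_of_inner_pos he2).and
      ((hn (w + e • v)).and (hn (w - e • v))))))).exists
    have hpre : IsPreconnected (ball q δ ∩ ball c (dist q c)) :=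
      ((convex_ball q δ).inter (convex_ball c _)).isPreconnected
    have hcont : ContinuousOn f (ball q δ ∩ ball c (dist q c)) :=
      hfc.mono (inter_subset_left.trans hδU)
    have hiv := hpre.intermediate_value ⟨h6, h4⟩ ⟨h5, h3⟩ hcont
    obtain ⟨y, hy, hy0⟩ := hiv ⟨by simpa using (neg_pos.1 h2).le, h1.le⟩
    have hyf : y ∈ frontier C ∩ U := by
      rw [hfr]
      exact ⟨hδU hy.1, hy0⟩
    have := le_dist_of_mem_frontier hball hyf.1
    have h7 : dist y c < dist q c := hy.2
    linarith
  refine le_antisymm (not_lt.1 (key w hw)) ?_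
  have := not_lt.1 (key (-w) (by simp [hw]))
  rw [inner_neg_right] at this
  linarith

/-- If a ball inside `C` touches the boundary of `C` at `q` and lies on the side of the boundary
where `f` is positive, then that whole side belongs to `C`: points near `q` can be moved into the
ball along the normal direction without meeting the boundary. -/
theorem eventually_mem_of_pos_side {E : Type*} [NormedAddCommGroup E]
    [InnerProductSpace ℝ E] {C U : Set E} {f : E → ℝ} {f' : E →L[ℝ] ℝ} {c q : E} {r : ℝ}
    (hU : IsOpen U) (hqU : q ∈ U) (hf : HasStrictFDerivAt f f' q)
    (hfr : frontier C ∩ U = {y ∈ U | f y = 0})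
    (hball : closedBall c r ⊆ C) (hr : dist q c = r) (hr0 : 0 < r) (hpos : 0 < f' (c - q)) :
    ∀ᶠ x in 𝓝 q, 0 < f x → x ∈ C := by
  set n := c - q with hn
  have hn0 : 0 < ‖n‖ := by rw [hn, ← dist_eq_norm, dist_comm, hr]; exact hr0
  have hstrict : ∃ δ > 0, ball q δ ⊆ U ∧ ∀ x ∈ ball q δ, ∀ s : ℝ, 0 ≤ s → x + s • n ∈ ball q δ →
      f x ≤ f (x + s • n) := by
    have h1 := hf.isLittleO
    have h2 := h1.def (show 0 < f' n / ‖n‖ by positivity)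
    rw [nhds_prod_eq] at h2
    obtain ⟨V, hV, hV2⟩ := (eventually_prod_self_iff (r := fun x y =>
      ‖f x - f y - f' (x - y)‖ ≤ f' n / ‖n‖ * ‖x - y‖)).1 h2
    obtain ⟨δ, hδ, hδV⟩ := Metric.mem_nhds_iff.1 (inter_mem hV (hU.mem_nhds hqU))
    refine ⟨δ, hδ, fun x hx => (hδV hx).2, fun x hx s hs hxs => ?_⟩
    have h3 := hV2 _ (hδV hxs).1 _ (hδV hx).1
    rw [add_sub_cancel_left, map_smul, norm_smul, Real.norm_eq_abs, Real.norm_eq_abs,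
      abs_of_nonneg hs, smul_eq_mul] at h3
    have h4 : f' n / ‖n‖ * (s * ‖n‖) = s * f' n := by field_simp
    rw [h4] at h3
    linarith [(abs_le.1 h3).1]
  obtain ⟨δ, hδ, hδU, hmono⟩ := hstrict
  -- A fixed step length that leads from `q` into the ball and stays near `q`.
  obtain ⟨s₀, hs0, hs1, hs2⟩ : ∃ s : ℝ, 0 < s ∧ s < 1 ∧ s * ‖n‖ < δ / 2 := by
    refine ⟨min (1 / 2) (δ / 4 / ‖n‖), by positivity, ?_, ?_⟩
    · exact (min_le_left _ _).trans_lt (by norm_num)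
    · calc min (1 / 2) (δ / 4 / ‖n‖) * ‖n‖ ≤ δ / 4 / ‖n‖ * ‖n‖ := by gcongr; exact min_le_right _ _
        _ = δ / 4 := by field_simp
        _ < δ / 2 := by linarith
  have hend : ∀ᶠ x in 𝓝 q, x + s₀ • n ∈ ball c r := by
    have hc : Continuous fun x : E => x + s₀ • n := by fun_prop
    refine (hc.tendsto q).eventually (isOpen_ball.mem_nhds ?_)
    have : q + s₀ • n - c = -((1 - s₀) • n) := by
      rw [hn]; module
    rw [mem_ball, dist_eq_norm, this, norm_neg, norm_smul, Real.norm_eq_abs,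
      abs_of_pos (by linarith)]
    have : ‖n‖ = r := by rw [hn, ← dist_eq_norm, dist_comm, hr]
    rw [this]
    nlinarith
  filter_upwards [hend, ball_mem_nhds q (half_pos hδ)] with x hx hxδ hfx
  have hxδ' : dist x q < δ / 2 := hxδ
  have hpath : ∀ s ∈ Icc (0 : ℝ) s₀, x + s • n ∈ ball q δ := by
    intro s hs
    rw [mem_ball]
    calc dist (x + s • n) q ≤ dist (x + s • n) x + dist x q := dist_triangle _ _ _
      _ = s * ‖n‖ + dist x q := by
          rw [dist_eq_norm, add_sub_cancel_left, norm_smul, Real.norm_eq_abs, abs_of_nonneg hs.1]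
      _ ≤ s₀ * ‖n‖ + dist x q := by gcongr; exact hs.2
      _ < δ := by linarith
  have hx0 : x ∈ ball q δ := by simpa using hpath 0 ⟨le_rfl, hs0.le⟩
  have hpre : IsPreconnected ((fun s : ℝ => x + s • n) '' Icc 0 s₀) :=
    isPreconnected_Icc.image _ (by fun_prop)
  refine interior_subset (subset_interior_of_disjoint_frontier hpre ?_ ?_ ⟨0, ⟨le_rfl, hs0.le⟩, by simp⟩)
  · rw [Set.disjoint_left]
    rintro _ ⟨s, hs, rfl⟩ hfs
    have h1 : x + s • n ∈ frontier C ∩ U := ⟨hfs, hδU (hpath s hs)⟩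
    rw [hfr] at h1
    have h2 := hmono x hx0 s hs.1 (hpath s hs)
    have h3 : f (x + s • n) = 0 := h1.2
    linarith
  · exact ⟨_, ⟨s₀, ⟨hs0.le, le_rfl⟩, rfl⟩, hball (ball_subset_closedBall hx)⟩

/-- Two balls inside `C` that touch the boundary of `C` at the same point have their centers on
the same inner normal. -/
theorem touching_balls_aligned {d : ℕ} {C : Set (Pt d)} (hC : IsClosed C)
    (hfr : IsC2Hypersurface (frontier C)) {q c₁ c₂ : Pt d} {r₁ r₂ : ℝ} (hq : q ∈ frontier C)
    (hb₁ : closedBall c₁ r₁ ⊆ C) (hb₂ : closedBall c₂ r₂ ⊆ C) (hd₁ : dist q c₁ = r₁)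
    (hd₂ : dist q c₂ = r₂) (hr₁ : 0 < r₁) (hr₂ : 0 < r₂) :
    r₂ • (c₁ - q) = r₁ • (c₂ - q) := by
  obtain ⟨U, f, hU, hqU, hf, hf0, hfU⟩ := hfr q hq
  have hq0 : f q = 0 := by
    have : q ∈ frontier C ∩ U := ⟨hq, hqU⟩
    rw [hfU] at this
    exact this.2
  have hstr : HasStrictFDerivAt f (fderiv ℝ f q) q :=
    (hf.contDiffAt (hU.mem_nhds hqU)).hasStrictFDerivAt (by norm_num)
  have hneg : frontier C ∩ U = {y ∈ U | (-f) y = 0} := by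
    rw [hfU]; ext y; simp
  set f' := fderiv ℝ f q with hf'
  have hne : f' ≠ 0 := hf0 q hqU
  have hker₁ : ∀ w, f' w = 0 → ⟪c₁ - q, w⟫ = 0 := fun w hw =>
    inner_eq_zero_of_touching hU hqU hf.continuousOn hstr.hasFDerivAt hq0 hne hfU hb₁ hd₁ hw
  have hker₂ : ∀ w, f' w = 0 → ⟪c₂ - q, w⟫ = 0 := fun w hw =>
    inner_eq_zero_of_touching hU hqU hf.continuousOn hstr.hasFDerivAt hq0 hne hfU hb₂ hd₂ hw
  obtain ⟨v, hv⟩ : ∃ v, f' v = 1 := by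
    obtain ⟨v, hv⟩ : ∃ v, f' v ≠ 0 := by
      by_contra! hcon
      exact hne (ContinuousLinearMap.ext hcon)
    exact ⟨(f' v)⁻¹ • v, by simp [hv]⟩
  set α := ⟪c₁ - q, v⟫ with hα
  set β := ⟪c₂ - q, v⟫ with hβ
  have h₁ : ∀ x, ⟪c₁ - q, x⟫ = f' x * α := by
    intro x
    have := hker₁ (x - f' x • v) (by simp [hv])
    rw [inner_sub_right, inner_smul_right] at this
    linarith
  have h₂ : ∀ x, ⟪c₂ - q, x⟫ = f' x * β := by
    intro x
    have := hker₂ (x - f' x • v) (by simp [hv])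
    rw [inner_sub_right, inner_smul_right] at this
    linarith
  have hn₁ : ‖c₁ - q‖ = r₁ := by rw [← dist_eq_norm, dist_comm, hd₁]
  have hn₂ : ‖c₂ - q‖ = r₂ := by rw [← dist_eq_norm, dist_comm, hd₂]
  have hp₁ : 0 < f' (c₁ - q) * α := by
    rw [← h₁, real_inner_self_eq_norm_sq, hn₁]; positivity
  have hp₂ : 0 < f' (c₂ - q) * β := by
    rw [← h₂, real_inner_self_eq_norm_sq, hn₂]; positivity
  -- If the balls were on opposite sides, a neighborhood of `q` would be contained in `C`.
  have hopp : ∀ g : Pt d → ℝ, ∀ g' : Pt d →L[ℝ] ℝ, HasStrictFDerivAt g g' q →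
      frontier C ∩ U = {y ∈ U | g y = 0} → ∀ a₁ a₂ : Pt d, ∀ s₁ s₂ : ℝ, closedBall a₁ s₁ ⊆ C →
      closedBall a₂ s₂ ⊆ C → dist q a₁ = s₁ → dist q a₂ = s₂ → 0 < s₁ → 0 < s₂ →
      0 < g' (a₁ - q) → g' (a₂ - q) < 0 → False := by
    intro g g' hg hgU a₁ a₂ s₁ s₂ hba₁ hba₂ hda₁ hda₂ hs₁ hs₂ hpos hlt
    have e₁ := eventually_mem_of_pos_side hU hqU hg hgU hba₁ hda₁ hs₁ hpos
    have e₂ := eventually_mem_of_pos_side (f := -g) (f' := -g') hU hqU hg.neg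
      (by rw [hgU]; ext y; simp) hba₂ hda₂ hs₂ (by simpa using hlt)
    have : C ∈ 𝓝 q := by
      filter_upwards [e₁, e₂, hU.mem_nhds hqU] with x hx₁ hx₂ hxU
      rcases lt_trichotomy (g x) 0 with h | h | h
      · exact hx₂ (by simpa using h)
      · have : x ∈ frontier C ∩ U := by rw [hgU]; exact ⟨hxU, h⟩
        exact hC.frontier_subset this.1
      · exact hx₁ h
    exact hq.2 (mem_interior_iff_mem_nhds.2 this)
  have hsame : 0 < α * β := by
    rcases lt_or_gt_of_ne (show α ≠ 0 by rintro h; simp [h] at hp₁) with ha | ha <;>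
      rcases lt_or_gt_of_ne (show β ≠ 0 by rintro h; simp [h] at hp₂) with hb | hb
    · exact mul_pos_of_neg_of_neg ha hb
    · exact (hopp f f' hstr hfU c₂ c₁ r₂ r₁ hb₂ hb₁ hd₂ hd₁ hr₂ hr₁ (by nlinarith)
        (by nlinarith)).elim
    · exact (hopp f f' hstr hfU c₁ c₂ r₁ r₂ hb₁ hb₂ hd₁ hd₂ hr₁ hr₂ (by nlinarith)
        (by nlinarith)).elim
    · exact mul_pos ha hb
  have hprop : β • (c₁ - q) = α • (c₂ - q) := by
    refine ext_inner_right ℝ fun x => ?_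
    rw [real_inner_smul_left, real_inner_smul_left, h₁, h₂]
    ring
  have hα0 : α ≠ 0 := by rintro h; simp [h] at hsame
  have hnorm : |β| * r₁ = |α| * r₂ := by
    have := congrArg norm hprop
    rwa [norm_smul, norm_smul, hn₁, hn₂, Real.norm_eq_abs, Real.norm_eq_abs] at this
  have hβα : β * r₁ = α * r₂ := by
    rcases pos_and_pos_or_neg_and_neg_of_mul_pos hsame with ⟨ha, hb⟩ | ⟨ha, hb⟩
    · rwa [abs_of_pos ha, abs_of_pos hb] at hnorm
    · rw [abs_of_neg ha, abs_of_neg hb] at hnorm; linarith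
  have : α • (r₂ • (c₁ - q)) = α • (r₁ • (c₂ - q)) := by
    rw [smul_smul, ← hβα, mul_comm β, ← smul_smul, hprop, smul_comm]
  exact smul_right_injective _ hα0 this

/-- The points of `C` at distance at least `ν` from the boundary of `C`. -/
def innerSet {d : ℕ} (C : Set (Pt d)) (ν : ℝ) : Set (Pt d) :=
  {x ∈ C | ν ≤ infDist x (frontier C)}

theorem frontier_nonempty_of_isCompact {d : ℕ} (hd : 0 < d) {C : Set (Pt d)} (hC : IsCompact C)
    (hne : C.Nonempty) : (frontier C).Nonempty := by
  have : Nonempty (Fin d) := ⟨⟨0, hd⟩⟩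
  exact nonempty_frontier_iff.2 ⟨hne, hC.ne_univ⟩

theorem closedBall_subset_of_mem_innerSet {d : ℕ} {C : Set (Pt d)} (hC : IsClosed C) {ν : ℝ}
    (hν : 0 < ν) {x : Pt d} (hx : x ∈ innerSet C ν) : closedBall x ν ⊆ C := by
  have h1 : ball x ν ⊆ C := by
    refine (subset_interior_of_disjoint_frontier (convex_ball x ν).isPreconnected ?_
      ⟨x, mem_ball_self hν, hx.1⟩).trans interior_subset
    rw [Set.disjoint_left]
    intro y hy hyf
    have := infDist_le_dist_of_mem (x := x) hyf
    rw [mem_ball, dist_comm] at hy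
    linarith [hx.2]
  rw [← closure_ball x hν.ne']
  exact hC.closure_subset_iff.2 h1

theorem mem_innerSet_of_closedBall_subset {d : ℕ} {C : Set (Pt d)} {ν : ℝ} (hν : 0 ≤ ν) {x : Pt d}
    (hne : (frontier C).Nonempty) (h : closedBall x ν ⊆ C) : x ∈ innerSet C ν := by
  refine ⟨h (mem_closedBall_self hν), (le_infDist hne).2 fun q hq => ?_⟩
  rw [dist_comm]
  exact le_dist_of_mem_frontier h hq

theorem exists_touching_ball_of_lt_curvatureRadius {d : ℕ} {C : Set (Pt d)} {ν : ℝ} (hν : 0 < ν)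
    (h : ν < curvatureRadius C) {q : Pt d} (hq : q ∈ frontier C) :
    ∃ y, dist q y = ν ∧ closedBall y ν ⊆ C := by
  have hne : {r | 0 ≤ r ∧ ∀ x ∈ frontier C, ∃ y, dist x y = r ∧ closedBall y r ⊆ C}.Nonempty := by
    by_contra hcon
    rw [not_nonempty_iff_eq_empty] at hcon
    rw [curvatureRadius, hcon, Real.sSup_empty] at h
    linarith
  obtain ⟨r, ⟨-, hr⟩, hνr⟩ := exists_lt_of_lt_csSup hne h
  obtain ⟨c, hc, hcC⟩ := hr q hq
  have hr0 : 0 < r := hν.trans hνr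
  have hnorm : ‖c - q‖ = r := by rw [← dist_eq_norm, dist_comm, hc]
  refine ⟨q + (ν / r) • (c - q), ?_, ?_⟩
  · rw [dist_comm, dist_eq_norm, add_sub_cancel_left, norm_smul, hnorm, Real.norm_eq_abs,
      abs_of_pos (by positivity)]
    field_simp
  · refine (closedBall_subset_closedBall' ?_).trans hcC
    have : q + (ν / r) • (c - q) - c = -((1 - ν / r) • (c - q)) := by module
    rw [dist_eq_norm, this, norm_neg, norm_smul, hnorm, Real.norm_eq_abs, abs_of_nonneg]
    · field_simp; linarith
    · rw [sub_nonneg, div_le_one hr0]; exact hνr.le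

/-- A point of `C` closer than `ν` to the boundary lies on the normal segment from a boundary point
to the center of the ball of radius `ν` touching there. -/
theorem exists_normal_segment {d : ℕ} {C : Set (Pt d)} (hC : IsClosed C)
    (hfr : IsC2Hypersurface (frontier C)) (hfne : (frontier C).Nonempty) {ν : ℝ} (hν : 0 < ν)
    (hroll : ∀ q ∈ frontier C, ∃ y, dist q y = ν ∧ closedBall y ν ⊆ C) {x : Pt d} (hx : x ∈ C)
    (hxν : infDist x (frontier C) < ν) :
    ∃ q ∈ frontier C, ∃ y ∈ innerSet C ν, dist q y = ν ∧ x ∈ segment ℝ q y := by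
  obtain ⟨q, hq, hqx⟩ := (isClosed_frontier).exists_infDist_eq_dist hfne x
  obtain ⟨y, hqy, hy⟩ := hroll q hq
  refine ⟨q, hq, y, mem_innerSet_of_closedBall_subset hν.le hfne hy, hqy, ?_⟩
  rcases (infDist_nonneg (x := x) (s := frontier C)).eq_or_lt with h0 | h0
  · rw [← h0] at hqx
    rw [dist_eq_zero.1 hqx.symm]
    exact left_mem_segment ℝ q y
  · set s := infDist x (frontier C) with hs
    have hball : closedBall x s ⊆ C := closedBall_subset_of_mem_innerSet hC h0 ⟨hx, le_rfl⟩
    have := touching_balls_aligned hC hfr hq hball hy (by rw [dist_comm, ← hqx]) hqy h0 hν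
    rw [segment_eq_image']
    refine ⟨s / ν, ⟨by positivity, (div_le_one hν).2 hxν.le⟩, ?_⟩
    have h2 : (s / ν) • (y - q) = x - q := by
      rw [div_eq_inv_mul, ← smul_smul, ← this, smul_smul, inv_mul_cancel₀ hν.ne', one_smul]
    simp only [h2]
    abel

theorem exists_mem_innerSet_dist_le {d : ℕ} {C : Set (Pt d)} (hC : IsClosed C)
    (hfr : IsC2Hypersurface (frontier C)) (hfne : (frontier C).Nonempty) {ν : ℝ} (hν : 0 < ν)
    (hroll : ∀ q ∈ frontier C, ∃ y, dist q y = ν ∧ closedBall y ν ⊆ C) {x : Pt d} (hx : x ∈ C) :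
    ∃ y ∈ innerSet C ν, dist x y ≤ ν := by
  rcases lt_or_ge (infDist x (frontier C)) ν with h | h
  · obtain ⟨q, -, y, hy, hqy, hxs⟩ := exists_normal_segment hC hfr hfne hν hroll hx h
    refine ⟨y, hy, ?_⟩
    have := dist_add_dist_of_mem_segment hxs
    linarith [dist_nonneg (x := q) (y := x)]
  · exact ⟨x, ⟨hx, h⟩, by simpa using hν.le⟩

/-- The normal segments over a closed part `F` of the inner set. -/
def normalHull {d : ℕ} (C : Set (Pt d)) (ν : ℝ) (F : Set (Pt d)) : Set (Pt d) :=
  (innerSet C ν ∩ F) ∪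
    {x | ∃ q ∈ frontier C, ∃ y ∈ innerSet C ν ∩ F, dist q y = ν ∧ x ∈ segment ℝ q y}

theorem isClosed_innerSet {d : ℕ} {C : Set (Pt d)} (hC : IsClosed C) (ν : ℝ) :
    IsClosed (innerSet C ν) :=
  hC.inter (isClosed_le continuous_const (continuous_infDist_pt _))

theorem isClosed_normalHull {d : ℕ} {C : Set (Pt d)} (hC : IsCompact C) (ν : ℝ)
    {F : Set (Pt d)} (hF : IsClosed F) : IsClosed (normalHull C ν F) := by
  have hA : IsCompact (innerSet C ν ∩ F) :=
    hC.of_isClosed_subset ((isClosed_innerSet hC.isClosed ν).inter hF)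
      (inter_subset_left.trans (sep_subset _ _))
  have hB : IsCompact (frontier C) :=
    hC.of_isClosed_subset isClosed_frontier hC.isClosed.frontier_subset
  refine hA.isClosed.union ?_
  have hK : IsCompact (((frontier C ×ˢ (innerSet C ν ∩ F)) ∩ {z : Pt d × Pt d | dist z.1 z.2 = ν})
      ×ˢ Icc (0 : ℝ) 1) :=
    ((hB.prod hA).inter_right
      (isClosed_eq (continuous_fst.dist continuous_snd) continuous_const)).prod isCompact_Icc
  have himg := hK.image (f := fun z : (Pt d × Pt d) × ℝ => z.1.1 + z.2 • (z.1.2 - z.1.1))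
    (by fun_prop)
  convert himg.isClosed using 1
  ext x
  simp only [segment_eq_image', mem_ofPred_eq, mem_image, mem_prod, mem_inter_iff, Prod.exists]
  constructor
  · rintro ⟨q, hq, y, hy, hqy, s, hs, rfl⟩
    exact ⟨q, y, s, ⟨⟨⟨hq, hy⟩, hqy⟩, hs⟩, rfl⟩
  · rintro ⟨q, y, s, ⟨⟨⟨hq, hy⟩, hqy⟩, hs⟩, rfl⟩
    exact ⟨q, hq, y, hy, hqy, s, hs, rfl⟩

/-- A connected compact set with smooth boundary stays connected when the points closer than `ν`
to its boundary are removed, for `ν` below the curvature radius. A separation of the inner set would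
extend along the normal segments, which only meet in common end points, to one of `C`. -/
theorem isPreconnected_innerSet {d : ℕ} {C : Set (Pt d)} (hC : IsCompact C)
    (hconn : IsPreconnected C) (hfr : IsC2Hypersurface (frontier C))
    (hfne : (frontier C).Nonempty) {ν : ℝ} (hν : 0 < ν)
    (hroll : ∀ q ∈ frontier C, ∃ y, dist q y = ν ∧ closedBall y ν ⊆ C) :
    IsPreconnected (innerSet C ν) := by
  rw [isPreconnected_closed_iff]
  intro F₁ F₂ hF₁ hF₂ hcov ⟨x₁, hx₁, hxF₁⟩ ⟨x₂, hx₂, hxF₂⟩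
  have hcovC : C ⊆ normalHull C ν F₁ ∪ normalHull C ν F₂ := by
    intro x hx
    rcases lt_or_ge (infDist x (frontier C)) ν with h | h
    · obtain ⟨q, hq, y, hy, hqy, hxs⟩ := exists_normal_segment hC.isClosed hfr hfne hν hroll hx h
      rcases hcov hy with h' | h'
      · exact Or.inl (Or.inr ⟨q, hq, y, ⟨hy, h'⟩, hqy, hxs⟩)
      · exact Or.inr (Or.inr ⟨q, hq, y, ⟨hy, h'⟩, hqy, hxs⟩)
    · rcases hcov ⟨hx, h⟩ with h' | h'
      · exact Or.inl (Or.inl ⟨⟨hx, h⟩, h'⟩)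
      · exact Or.inr (Or.inl ⟨⟨hx, h⟩, h'⟩)
  obtain ⟨x, -, hxa, hxb⟩ := isPreconnected_closed_iff.1 hconn _ _
    (isClosed_normalHull hC ν hF₁) (isClosed_normalHull hC ν hF₂) hcovC
    ⟨x₁, hx₁.1, Or.inl ⟨hx₁, hxF₁⟩⟩ ⟨x₂, hx₂.1, Or.inl ⟨hx₂, hxF₂⟩⟩
  -- A point of the inner set on a normal segment is the inner end point.
  have hend : ∀ q y : Pt d, q ∈ frontier C → dist q y = ν → x ∈ innerSet C ν →
      x ∈ segment ℝ q y → x = y := by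
    intro q y hq hqy hx hxs
    have h1 := dist_add_dist_of_mem_segment hxs
    have h2 := infDist_le_dist_of_mem (x := x) hq
    have h3 := hx.2
    rw [dist_comm] at h2
    exact dist_le_zero.1 (by linarith)
  rcases hxa with ⟨hxM, hxa⟩ | ⟨q₁, hq₁, y₁, ⟨hyM₁, hy₁⟩, hqy₁, hs₁⟩
  · rcases hxb with ⟨-, hxb⟩ | ⟨q₂, hq₂, y₂, ⟨hyM₂, hy₂⟩, hqy₂, hs₂⟩
    · exact ⟨x, hxM, hxa, hxb⟩
    · rw [← hend q₂ y₂ hq₂ hqy₂ hxM hs₂] at hy₂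
      exact ⟨x, hxM, hxa, hy₂⟩
  · rcases hxb with ⟨hxM, hxb⟩ | ⟨q₂, hq₂, y₂, ⟨hyM₂, hy₂⟩, hqy₂, hs₂⟩
    · rw [← hend q₁ y₁ hq₁ hqy₁ hxM hs₁] at hy₁
      exact ⟨x, hxM, hy₁, hxb⟩
    · have hb₁ := closedBall_subset_of_mem_innerSet hC.isClosed hν hyM₁
      have hb₂ := closedBall_subset_of_mem_innerSet hC.isClosed hν hyM₂
      have e₁ := dist_add_dist_of_mem_segment hs₁
      have e₂ := dist_add_dist_of_mem_segment hs₂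
      -- The segment with the larger distance to its inner end touches the other ball as well.
      have hkey : y₁ = y₂ := by
        rcases le_total (dist q₁ x) (dist q₂ x) with h | h
        · have h1 : dist q₁ y₂ = ν := le_antisymm
            (by linarith [dist_triangle q₁ x y₂]) (le_dist_of_mem_frontier hb₂ hq₁)
          have := touching_balls_aligned hC.isClosed hfr hq₁ hb₁ hb₂ hqy₁ h1 hν hν
          exact sub_left_injective (smul_right_injective _ hν.ne' this)
        · have h1 : dist q₂ y₁ = ν := le_antisymm
            (by linarith [dist_triangle q₂ x y₁]) (le_dist_of_mem_frontier hb₁ hq₂)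
          have := touching_balls_aligned hC.isClosed hfr hq₂ hb₁ hb₂ h1 hqy₂ hν hν
          exact sub_left_injective (smul_right_injective _ hν.ne' this)
      rw [← hkey] at hy₂
      exact ⟨y₁, hyM₁, hy₁, hy₂⟩

theorem volume_real_ball {d : ℕ} (x : Pt d) {r : ℝ} (hr : 0 < r) :
    (volume : Measure (Pt d)).real (ball x r) = r ^ d * unitBallVolume d := by
  rw [unitBallVolume, measureReal_def, Measure.addHaar_ball_of_pos _ _ hr, finrank_euclideanSpace_fin,
    ENNReal.toReal_mul, ENNReal.toReal_ofReal (by positivity), measureReal_def]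

theorem unitBallVolume_pos (d : ℕ) : 0 < unitBallVolume d :=
  ENNReal.toReal_pos (measure_ball_pos _ _ one_pos).ne' measure_ball_lt_top.ne

theorem card_mul_le_volume {d : ℕ} {C : Set (Pt d)} (hC : IsCompact C) {ν : ℝ} (hν : 0 < ν)
    {T : Finset (Pt d)} (hT : ∀ y ∈ T, closedBall y ν ⊆ C)
    (hsep : ∀ y ∈ T, ∀ y' ∈ T, y ≠ y' → ν ≤ dist y y') :
    (T.card : ℝ) * ((ν / 2) ^ d * unitBallVolume d) ≤ (volume : Measure (Pt d)).real C := by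
  have h1 : (volume : Measure (Pt d)).real (⋃ y ∈ T, ball y (ν / 2)) =
      ∑ y ∈ T, (volume : Measure (Pt d)).real (ball y (ν / 2)) := by
    refine measureReal_biUnion_finset ?_ (fun _ _ => measurableSet_ball)
      (h := fun _ _ => measure_ball_lt_top.ne)
    intro y hy y' hy' hne
    refine ball_disjoint_ball ?_
    linarith [hsep y hy y' hy' hne]
  have h2 : (⋃ y ∈ T, ball y (ν / 2)) ⊆ C :=
    iUnion₂_subset fun y hy => (ball_subset_closedBall.trans
      (closedBall_subset_closedBall (by linarith))).trans (hT y hy)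
  calc (T.card : ℝ) * ((ν / 2) ^ d * unitBallVolume d)
      = ∑ y ∈ T, (volume : Measure (Pt d)).real (ball y (ν / 2)) := by
        rw [Finset.sum_congr rfl fun y _ => volume_real_ball y (half_pos hν)]
        simp
    _ = _ := h1.symm
    _ ≤ _ := measureReal_mono h2 hC.measure_lt_top.ne

/-- A maximal separated subset of the inner set: its points are centers of balls in `C`, it is
a net of the inner set, and its cardinality is bounded by a packing argument. -/
theorem exists_finite_net {d : ℕ} {C : Set (Pt d)} (hC : IsCompact C) {ν : ℝ} (hν : 0 < ν) :
    ∃ T : Finset (Pt d), (∀ y ∈ T, closedBall y ν ⊆ C) ∧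
      (∀ x ∈ innerSet C ν, ∃ y ∈ T, dist x y < ν) ∧
      (T.card : ℝ) * ((ν / 2) ^ d * unitBallVolume d) ≤ (volume : Measure (Pt d)).real C := by
  classical
  let P : ℕ → Prop := fun N => ∃ T : Finset (Pt d), T.card = N ∧ (∀ y ∈ T, y ∈ innerSet C ν) ∧
    ∀ y ∈ T, ∀ y' ∈ T, y ≠ y' → ν ≤ dist y y'
  let B : ℕ := ⌊(volume : Measure (Pt d)).real C / ((ν / 2) ^ d * unitBallVolume d)⌋₊
  have hb : ∀ N, P N → N ≤ B := by
    rintro N ⟨T, rfl, hT, hsep⟩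
    have hpos : 0 < (ν / 2) ^ d * unitBallVolume d :=
      mul_pos (by positivity) (unitBallVolume_pos d)
    refine Nat.le_floor ?_
    rw [le_div_iff₀ hpos]
    exact card_mul_le_volume hC hν
      (fun y hy => closedBall_subset_of_mem_innerSet hC.isClosed hν (hT y hy)) hsep
  have h0 : P 0 := ⟨∅, by simp⟩
  obtain ⟨T, hcard, hT, hsep⟩ := Nat.findGreatest_spec (P := P) (Nat.zero_le B) h0
  have hTC : ∀ y ∈ T, closedBall y ν ⊆ C :=
    fun y hy => closedBall_subset_of_mem_innerSet hC.isClosed hν (hT y hy)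
  refine ⟨T, hTC, fun x hx => ?_, card_mul_le_volume hC hν hTC hsep⟩
  by_contra! hcon
  have hxT : x ∉ T := fun h => by
    have := hcon x h
    rw [dist_self] at this
    linarith
  have hP : P (T.card + 1) := by
    refine ⟨insert x T, Finset.card_insert_of_notMem hxT, ?_, ?_⟩
    · intro y hy
      rcases Finset.mem_insert.1 hy with rfl | hy
      · exact hx
      · exact hT y hy
    · intro y hy y' hy' hne
      rcases Finset.mem_insert.1 hy with hyx | hy <;>
        rcases Finset.mem_insert.1 hy' with hyx' | hy'
      · exact (hne (hyx.trans hyx'.symm)).elim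
      · rw [hyx]; exact hcon y' hy'
      · rw [hyx', dist_comm]; exact hcon y hy
      · exact hsep y hy y' hy' hne
  have := Nat.le_findGreatest (hb _ hP) hP
  rw [← hcard] at this
  exact Nat.not_succ_le_self _ this

theorem coveringRadius_le_curvatureRadius {d : ℕ} (C : Set (Pt d)) (h : 0 ≤ curvatureRadius C) :
    coveringRadius C ≤ curvatureRadius C :=
  Real.sSup_le (fun _ hν => hν.2.1) h

/-- If every ball of the net contains a sample point and every pair of sample points of `C` at
distance at most `4 ν` is joined, then the sample points of `C` are connected through sample points
of `C`. -/
theorem reachable_of_net {d n : ℕ} {C : Set (Pt d)} {ν : ℝ}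
    (hν : 0 < ν) (hpre : IsPreconnected (innerSet C ν))
    (hnear : ∀ x ∈ C, ∃ y ∈ innerSet C ν, dist x y ≤ ν) {T : Finset (Pt d)}
    (hT : ∀ y ∈ T, closedBall y ν ⊆ C) (hnet : ∀ x ∈ innerSet C ν, ∃ y ∈ T, dist x y < ν)
    {x : Fin n → Pt d} (hocc : ∀ y ∈ T, ∃ a, x a ∈ ball y ν) {S : Set (Fin n)}
    {G : SimpleGraph S} (hS : ∀ a, x a ∈ C → a ∈ S)
    (hG : ∀ a b : S, a ≠ b → x a ∈ C → x b ∈ C → dist (x a) (x b) ≤ 4 * ν → G.Adj a b)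
    (a b : S) (ha : x a ∈ C) (hb : x b ∈ C) : G.Reachable a b := by
  have hstep : ∀ a b : S, x a ∈ C → x b ∈ C → dist (x a) (x b) ≤ 4 * ν → G.Reachable a b := by
    intro a b ha hb hab
    by_cases h : a = b
    · rw [h]
    · exact (hG a b h ha hb hab).reachable
  -- The closed neighborhoods of the net points that belong to the component of `a`, and of
  -- the other ones, cover the inner set.
  let J : Set (Pt d) := {y | y ∈ T ∧ ∃ c : S, x c ∈ ball y ν ∧ G.Reachable a c}
  have hreach : ∀ c : S, x c ∈ C → ∃ y ∈ T, ∃ z : Pt d, z ∈ innerSet C ν ∧ dist z y < ν ∧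
      ∀ e : S, x e ∈ ball y ν → G.Reachable c e := by
    intro c hc
    obtain ⟨z, hz, hcz⟩ := hnear (x c) hc
    obtain ⟨y, hy, hzy⟩ := hnet z hz
    refine ⟨y, hy, z, hz, hzy, fun e he => hstep c e hc (hT y hy (ball_subset_closedBall he)) ?_⟩
    rw [mem_ball, dist_comm] at he
    linarith [dist_triangle4 (x c) z y (x e)]
  have hoccS : ∀ y ∈ T, ∃ e : S, x e ∈ ball y ν := fun y hy => by
    obtain ⟨e, he⟩ := hocc y hy
    exact ⟨⟨e, hS e (hT y hy (ball_subset_closedBall he))⟩, he⟩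
  obtain ⟨y₁, hy₁, z₁, hz₁, hzy₁, hr₁⟩ := hreach a ha
  obtain ⟨y₂, hy₂, z₂, hz₂, hzy₂, hr₂⟩ := hreach b hb
  have hall : ∀ y ∈ T, y ∈ J → ∀ e : S, x e ∈ ball y ν → G.Reachable a e := by
    rintro y hy ⟨-, c, hc, hac⟩ e he
    refine hac.trans (hstep c e (hT y hy (ball_subset_closedBall hc))
      (hT y hy (ball_subset_closedBall he)) ?_)
    rw [mem_ball] at hc he
    linarith [dist_triangle_right (x c) (x e) y]
  obtain ⟨e₁, he₁⟩ := hoccS y₁ hy₁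
  have hy₁J : y₁ ∈ J := ⟨hy₁, e₁, he₁, hr₁ e₁ he₁⟩
  suffices hy₂J : y₂ ∈ J by
    obtain ⟨e₂, he₂⟩ := hoccS y₂ hy₂
    exact (hall y₂ hy₂ hy₂J e₂ he₂).trans (hr₂ e₂ he₂).symm
  by_contra hy₂J
  have hfin : ∀ J' : Set (Pt d), IsClosed (⋃ y ∈ {y ∈ (T : Set (Pt d)) | y ∈ J'}, closedBall y ν) :=
    fun J' => (T.finite_toSet.subset (sep_subset _ _)).isClosed_biUnion fun _ _ => isClosed_closedBall
  obtain ⟨z, hz, hzJ, hzJ'⟩ := isPreconnected_closed_iff.1 hpre _ _ (hfin J) (hfin Jᶜ)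
    (fun z hz => by
      obtain ⟨y, hy, hzy⟩ := hnet z hz
      by_cases h : y ∈ J
      · exact Or.inl (mem_biUnion ⟨hy, h⟩ (mem_closedBall.2 hzy.le))
      · exact Or.inr (mem_biUnion ⟨hy, h⟩ (mem_closedBall.2 hzy.le)))
    ⟨z₁, hz₁, mem_biUnion ⟨hy₁, hy₁J⟩ (mem_closedBall.2 hzy₁.le)⟩
    ⟨z₂, hz₂, mem_biUnion ⟨hy₂, hy₂J⟩ (mem_closedBall.2 hzy₂.le)⟩
  obtain ⟨y, ⟨hy, hyJ⟩, hzy⟩ := mem_iUnion₂.1 hzJ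
  obtain ⟨y', ⟨hy', hyJ'⟩, hzy'⟩ := mem_iUnion₂.1 hzJ'
  obtain ⟨e, he⟩ := hoccS y hy
  obtain ⟨e', he'⟩ := hoccS y' hy'
  refine hyJ' ⟨hy', e', he', (hall y hy hyJ e he).trans (hstep e e'
    (hT y hy (ball_subset_closedBall he)) (hT y' hy' (ball_subset_closedBall he')) ?_)⟩
  rw [mem_ball] at he he'
  rw [mem_closedBall, dist_comm] at hzy
  rw [mem_closedBall] at hzy'
  have h1 := dist_triangle4 (x e) y y' (x e')
  have h2 := dist_triangle y z y'
  rw [dist_comm y' (x e')] at h1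
  linarith

/-! ### Exponential bounds for sums over a sample -/

/-- Chernoff's bound for independent summands. -/
theorem pi_sum_ge_le_exp {α : Type*} [MeasurableSpace α] (μ : Measure α) [IsProbabilityMeasure μ]
    {n : ℕ} {f : α → ℝ} {β : ℝ} (hint : Integrable (fun x => Real.exp (f x)) μ)
    (hβ : ∫ x, Real.exp (f x) ∂μ ≤ Real.exp β) (τ : ℝ) :
    (Measure.pi fun _ : Fin n => μ).real {x | τ ≤ ∑ j, f (x j)} ≤ Real.exp (n * β - τ) := by
  have h1 := mul_meas_ge_le_integral_of_nonneg (μ := Measure.pi fun _ : Fin n => μ)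
    (f := fun x => ∏ j, Real.exp (f (x j)))
    (Eventually.of_forall fun x => Finset.prod_nonneg fun j _ => (Real.exp_pos _).le)
    (Integrable.fintype_prod (fun _ => hint)) (Real.exp τ)
  rw [integral_fintype_prod_eq_pow (fun x => Real.exp (f x)), Fintype.card_fin] at h1
  have h2 : {x : Fin n → α | Real.exp τ ≤ ∏ j, Real.exp (f (x j))} = {x | τ ≤ ∑ j, f (x j)} := by
    ext x
    simp only [mem_ofPred_eq, ← Real.exp_sum, Real.exp_le_exp]
  rw [h2] at h1
  rw [Real.exp_sub, le_div_iff₀ (Real.exp_pos _), mul_comm, Real.exp_nat_mul]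
  exact h1.trans (pow_le_pow_left₀ (integral_nonneg fun x => (Real.exp_pos _).le) hβ n)

/-- Chernoff's bound for the summands that involve a fixed sample point, conditionally on the
position of this point. -/
theorem pi_leaveOneOut_ge_le_exp {α : Type*} [MeasurableSpace α] (μ : Measure α)
    [IsProbabilityMeasure μ] {n : ℕ} (a : Fin (n + 1)) {A : Set α} (hA : MeasurableSet A)
    {f : α → α → ℝ} (hf : Measurable (Function.uncurry f)) {β : ℝ}
    (hint : ∀ y ∈ A, Integrable (fun x => Real.exp (f y x)) μ)
    (hβ : ∀ y ∈ A, ∫ x, Real.exp (f y x) ∂μ ≤ Real.exp β) (τ : ℝ) :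
    (Measure.pi fun _ : Fin (n + 1) => μ).real
      {x | x a ∈ A ∧ τ ≤ ∑ j, f (x a) (x (a.succAbove j))} ≤
      μ.real A * Real.exp (n * β - τ) := by
  have hmp := measurePreserving_piFinSuccAbove (fun _ : Fin (n + 1) => μ) a
  set S : Set (α × (Fin n → α)) := {z | z.1 ∈ A ∧ τ ≤ ∑ j, f z.1 (z.2 j)} with hS
  have hSm : MeasurableSet S := by
    have h1 : Measurable fun z : α × (Fin n → α) => ∑ j, f z.1 (z.2 j) :=
      Finset.measurable_sum _ fun j _ =>
        hf.comp (measurable_fst.prodMk ((measurable_pi_apply j).comp measurable_snd))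
    exact (measurable_fst hA).inter (measurableSet_le measurable_const h1)
  have hpre : {x : Fin (n + 1) → α | x a ∈ A ∧ τ ≤ ∑ j, f (x a) (x (a.succAbove j))} =
      MeasurableEquiv.piFinSuccAbove (fun _ => α) a ⁻¹' S := rfl
  rw [hpre, measureReal_def, hmp.measure_preimage hSm.nullMeasurableSet,
    Measure.prod_apply hSm]
  have hle : ∀ y, (Measure.pi fun _ : Fin n => μ) (Prod.mk y ⁻¹' S) ≤
      A.indicator (fun _ => ENNReal.ofReal (Real.exp (n * β - τ))) y := by
    intro y
    by_cases hy : y ∈ A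
    · rw [indicator_of_mem hy]
      have h1 := pi_sum_ge_le_exp μ (n := n) (hint y hy) (hβ y hy) τ
      rw [← ofReal_measureReal]
      refine ENNReal.ofReal_le_ofReal (le_trans (measureReal_mono ?_) h1)
      rintro z ⟨-, hz⟩
      exact hz
    · have : Prod.mk y ⁻¹' S = ∅ := by
        ext z; simp [hS, hy]
      rw [this]; simp
  refine ENNReal.toReal_le_of_le_ofReal (by positivity) ((lintegral_mono hle).trans ?_)
  rw [lintegral_indicator hA, setLIntegral_const, mul_comm, ENNReal.ofReal_mul measureReal_nonneg,
    ofReal_measureReal]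

theorem integrable_exp_mul_indicator {α : Type*} [MeasurableSpace α] (μ : Measure α)
    [IsProbabilityMeasure μ] {B : Set α} (hB : MeasurableSet B) (l : ℝ) :
    Integrable (fun x => Real.exp (l * B.indicator 1 x)) μ := by
  have hm : Measurable fun x => Real.exp (l * B.indicator (1 : α → ℝ) x) :=
    Real.measurable_exp.comp ((measurable_one.indicator hB).const_mul l)
  refine Integrable.of_bound hm.aestronglyMeasurable (Real.exp |l|) (ae_of_all _ fun x => ?_)
  rw [Real.norm_eq_abs, Real.abs_exp, Real.exp_le_exp]
  by_cases h : x ∈ B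
  · simpa [h] using le_abs_self l
  · simp [h]

theorem integral_exp_mul_indicator_le {α : Type*} [MeasurableSpace α] (μ : Measure α)
    [IsProbabilityMeasure μ] {B : Set α} (hB : MeasurableSet B) {l c : ℝ}
    (hc : μ.real B * (Real.exp l - 1) ≤ c) :
    ∫ x, Real.exp (l * B.indicator 1 x) ∂μ ≤ Real.exp c := by
  have h1 : ∀ x, Real.exp (l * B.indicator 1 x) =
      1 + B.indicator (fun _ => Real.exp l - 1) x := by
    intro x
    by_cases h : x ∈ B <;> simp [h]
  simp_rw [h1]
  rw [integral_add (integrable_const _) ((integrable_const _).indicator hB),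
    integral_indicator hB, setIntegral_const]
  simp only [integral_const, probReal_univ, smul_eq_mul, mul_one]
  linarith [Real.add_one_le_exp c]

theorem sum_indicator_eq_ncard {α : Type*} {n : ℕ} (x : Fin n → α) (B : Set α) :
    ∑ j, B.indicator (1 : α → ℝ) (x j) = ({j | x j ∈ B}.ncard : ℝ) := by
  classical
  rw [Set.ncard_eq_toFinset_card', Set.toFinset_ofPred, Finset.card_filter]
  push_cast
  refine Finset.sum_congr rfl fun j _ => ?_
  by_cases h : x j ∈ B <;> simp [h]

theorem pi_mul_count_ge_le_exp {α : Type*} [MeasurableSpace α] (μ : Measure α)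
    [IsProbabilityMeasure μ] {n : ℕ} {B : Set α} (hB : MeasurableSet B) {l c : ℝ}
    (hc : μ.real B * (Real.exp l - 1) ≤ c) (τ : ℝ) :
    (Measure.pi fun _ : Fin n => μ).real {x | τ ≤ l * ({j | x j ∈ B}.ncard : ℝ)} ≤
      Real.exp (n * c - τ) := by
  have := pi_sum_ge_le_exp μ (n := n) (integrable_exp_mul_indicator μ hB l)
    (integral_exp_mul_indicator_le μ hB hc) τ
  simpa only [← Finset.mul_sum, sum_indicator_eq_ncard] using this

theorem ncard_ne_and_eq {n : ℕ} (a : Fin (n + 1)) (P : Fin (n + 1) → Prop) :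
    {l | l ≠ a ∧ P l}.ncard = {j | P (a.succAbove j)}.ncard := by
  rw [← Set.ncard_image_of_injective {j | P (a.succAbove j)} a.succAbove_right_injective]
  congr 1
  ext l
  simp only [mem_ofPred_eq, mem_image]
  constructor
  · rintro ⟨hl, hP⟩
    obtain ⟨j, rfl⟩ := Fin.exists_succAbove_eq hl
    exact ⟨j, hP, rfl⟩
  · rintro ⟨j, hj, rfl⟩
    exact ⟨Fin.succAbove_ne a j, hj⟩

theorem pi_mul_neighborCount_ge_le_exp {α : Type*} [PseudoMetricSpace α]
    [SecondCountableTopology α] [MeasurableSpace α] [OpensMeasurableSpace α] (μ : Measure α)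
    [IsProbabilityMeasure μ] {n : ℕ} (a : Fin (n + 1)) {A : Set α} (hA : MeasurableSet A)
    {l c r : ℝ} (hc : ∀ y ∈ A, μ.real (ball y r) * (Real.exp l - 1) ≤ c) (τ : ℝ) :
    (Measure.pi fun _ : Fin (n + 1) => μ).real
      {x | x a ∈ A ∧ τ ≤ l * ({j | j ≠ a ∧ dist (x j) (x a) < r}.ncard : ℝ)} ≤
      μ.real A * Real.exp (n * c - τ) := by
  have hm : Measurable (Function.uncurry fun y x : α => l * (ball y r).indicator (1 : α → ℝ) x) := by
    have h1 : MeasurableSet {z : α × α | dist z.2 z.1 < r} :=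
      measurableSet_lt (measurable_snd.dist measurable_fst) measurable_const
    have h2 : (Function.uncurry fun y x : α => l * (ball y r).indicator (1 : α → ℝ) x) =
        fun z : α × α => l * {z : α × α | dist z.2 z.1 < r}.indicator 1 z := by
      ext ⟨y, x⟩
      simp only [Function.uncurry, indicator, mem_ball, mem_ofPred_eq, Pi.one_apply]
    rw [h2]
    exact (measurable_one.indicator h1).const_mul l
  have := pi_leaveOneOut_ge_le_exp μ a hA hm
    (fun y _ => integrable_exp_mul_indicator μ measurableSet_ball l)
    (fun y hy => integral_exp_mul_indicator_le μ measurableSet_ball (hc y hy))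
    τ
  refine le_trans (le_of_eq ?_) this
  congr 1
  ext x
  simp only [mem_ofPred_eq, ← Finset.mul_sum]
  rw [sum_indicator_eq_ncard (fun j => x (a.succAbove j)), ncard_ne_and_eq]
  rfl

theorem one_sub_measureReal_le {α : Type*} [MeasurableSpace α] (μ : Measure α)
    [IsProbabilityMeasure μ] {s t : Set α} {c : ℝ} (hs : μ.real s ≤ c) (h : sᶜ ⊆ t) :
    1 - c ≤ μ.real t := by
  have h1 : (1 : ℝ) ≤ μ.real s + μ.real t := by
    rw [← probReal_univ (μ := μ)]
    refine (measureReal_mono ?_).trans (measureReal_union_le s t)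
    intro x _
    by_cases hx : x ∈ s
    · exact Or.inl hx
    · exact Or.inr (h hx)
  linarith

/-! ### The sampling measure -/

theorem isProbabilityMeasure_law {d : ℕ} {p : Pt d → ℝ} (hp : IsBoundedDensity p) :
    IsProbabilityMeasure (law p) :=
  ⟨by rw [law, withDensity_apply _ MeasurableSet.univ, Measure.restrict_univ,
    hp.lintegral_eq_one]⟩

theorem isProbabilityMeasure_sampleLaw {d : ℕ} {p : Pt d → ℝ} (hp : IsBoundedDensity p) (n : ℕ) :
    IsProbabilityMeasure (sampleLaw p n) := by
  have := isProbabilityMeasure_law hp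
  exact Measure.pi.instIsProbabilityMeasure _

theorem law_real_le {d : ℕ} {p : Pt d → ℝ} {B : Set (Pt d)} (hB : MeasurableSet B)
    (hBfin : volume B ≠ ⊤) {c : ℝ} (hc0 : 0 ≤ c) (hc : ∀ x ∈ B, p x ≤ c) :
    (law p).real B ≤ c * (volume : Measure (Pt d)).real B := by
  rw [measureReal_def, law, withDensity_apply _ hB]
  refine ENNReal.toReal_le_of_le_ofReal (by positivity) ?_
  calc ∫⁻ x in B, ENNReal.ofReal (p x) ≤ ∫⁻ _ in B, ENNReal.ofReal c :=
        setLIntegral_mono measurable_const fun x hx => ENNReal.ofReal_le_ofReal (hc x hx)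
    _ = _ := by rw [setLIntegral_const, ENNReal.ofReal_mul hc0, ofReal_measureReal hBfin]

theorem le_law_real {d : ℕ} {p : Pt d → ℝ} (hp : IsBoundedDensity p) {B : Set (Pt d)}
    (hB : MeasurableSet B) {c : ℝ} (hc : ∀ᵐ x, x ∈ B → c ≤ p x) :
    c * (volume : Measure (Pt d)).real B ≤ (law p).real B := by
  have := isProbabilityMeasure_law hp
  rcases le_total c 0 with h0 | h0
  · exact (mul_nonpos_of_nonpos_of_nonneg h0 measureReal_nonneg).trans measureReal_nonneg
  rw [← ENNReal.ofReal_le_ofReal_iff measureReal_nonneg, ofReal_measureReal (measure_ne_top _ _),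
    ENNReal.ofReal_mul h0]
  calc ENNReal.ofReal c * ENNReal.ofReal ((volume : Measure (Pt d)).real B)
      ≤ ENNReal.ofReal c * volume B := by
        gcongr
        exact ENNReal.ofReal_toReal_le
    _ = ∫⁻ _ in B, ENNReal.ofReal c := by rw [setLIntegral_const]
    _ ≤ ∫⁻ x in B, ENNReal.ofReal (p x) := by
        refine lintegral_mono_ae ?_
        rw [ae_restrict_iff' hB]
        filter_upwards [hc] with x hx hxB using ENNReal.ofReal_le_ofReal (hx hxB)
    _ = _ := by rw [law, withDensity_apply _ hB]

theorem le_maxDensity {d : ℕ} {p : Pt d → ℝ} (hp : IsBoundedDensity p) {C : Set (Pt d)} {x : Pt d}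
    (hx : x ∈ C) : p x ≤ maxDensity p C := by
  obtain ⟨M, hM⟩ := hp.bounded
  exact le_csSup ⟨M, by rintro _ ⟨y, -, rfl⟩; exact hM y⟩ ⟨x, hx, rfl⟩

theorem volume_real_pos_of_curvatureRadius_pos {d : ℕ} (hd : 0 < d) {C : Set (Pt d)}
    (hC : IsCompact C) (hne : C.Nonempty) (hκ : 0 < curvatureRadius C) :
    0 < (volume : Measure (Pt d)).real C := by
  obtain ⟨q, hq⟩ := frontier_nonempty_of_isCompact hd hC hne
  obtain ⟨y, -, hy⟩ := exists_touching_ball_of_lt_curvatureRadius (half_pos hκ) (half_lt_self hκ) hq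
  have h1 := measureReal_mono (μ := (volume : Measure (Pt d)))
    (ball_subset_closedBall.trans hy) hC.measure_lt_top.ne
  rw [volume_real_ball y (half_pos hκ)] at h1
  exact (mul_pos (pow_pos (half_pos hκ) d) (unitBallVolume_pos d)).trans_le h1

theorem le_maxDensity_of_ae {d : ℕ} {p : Pt d → ℝ} (hp : IsBoundedDensity p) {C : Set (Pt d)}
    {t : ℝ} (hvol : 0 < (volume : Measure (Pt d)).real C) (ht : ∀ᵐ x, x ∈ C → t ≤ p x) :
    t ≤ maxDensity p C := by
  by_contra! hlt
  have h1 : ∀ᵐ x, x ∉ C := by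
    filter_upwards [ht] with x hx hxC
    exact absurd (hx hxC) (not_le.2 ((le_maxDensity hp hxC).trans_lt hlt))
  have h2 : volume C = 0 := measure_eq_zero_iff_ae_notMem.2 h1
  rw [measureReal_def, h2] at hvol
  simp at hvol

/-! ### Connections within a cluster -/

/-- The sample points of `C` are connected through sample points of `C`: they are connected in
every induced subgraph that contains all of them. -/
def IsLinked {d n : ℕ} (C : Set (Pt d)) (k : ℕ) (x : Fin n → Pt d) : Prop :=
  ∀ S : Set (Fin n), (∀ a, x a ∈ C → a ∈ S) → ∀ a b : S, x a ∈ C → x b ∈ C →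
    ((mutualKNN k x).induce S).Reachable a b

theorem IsLinked.reachable {d n : ℕ} {C : Set (Pt d)} {k : ℕ} {x : Fin n → Pt d}
    (h : IsLinked C k x) {a b : Fin n} (ha : x a ∈ C) (hb : x b ∈ C) :
    (mutualKNN k x).Reachable a b :=
  (h univ (fun _ _ => mem_univ _) ⟨a, mem_univ _⟩ ⟨b, mem_univ _⟩ ha hb).map
    (SimpleGraph.Embedding.induce univ).toHom

/-- Points closer than the distance `r` to each other are mutual neighbors if both of them have
fewer than `k` sample points in their `r`-neighborhoods. -/
theorem mutualKNN_adj_of_dist_le {d n k : ℕ} {x : Fin n → Pt d} {r : ℝ} {a b : Fin n} (hab : a ≠ b)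
    (ha : {j | j ≠ a ∧ dist (x j) (x a) < r}.ncard < k)
    (hb : {j | j ≠ b ∧ dist (x j) (x b) < r}.ncard < k) (hr : dist (x a) (x b) ≤ r) :
    (mutualKNN k x).Adj a b := by
  have key : ∀ a b : Fin n, a ≠ b → {j | j ≠ b ∧ dist (x j) (x b) < r}.ncard < k →
      dist (x a) (x b) ≤ r → a ∈ kNN k x b := by
    intro a b hab hb hr
    refine ⟨hab, lt_of_le_of_lt (Set.ncard_le_ncard ?_ (Set.toFinite _)) hb⟩
    rintro j ⟨hj, hj2⟩
    exact ⟨hj, hj2.trans_le hr⟩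
  exact ⟨key a b hab hb hr, key b a hab.symm ha (by rwa [dist_comm])⟩

/-- A cluster is linked if no neighborhood of its sample points is overcrowded and no ball of
the net is empty. -/
theorem isLinked_of_net {d n : ℕ} {C : Set (Pt d)} {ν : ℝ}
    (hν : 0 < ν) (hpre : IsPreconnected (innerSet C ν))
    (hnear : ∀ x ∈ C, ∃ y ∈ innerSet C ν, dist x y ≤ ν) {T : Finset (Pt d)}
    (hT : ∀ y ∈ T, closedBall y ν ⊆ C) (hnet : ∀ x ∈ innerSet C ν, ∃ y ∈ T, dist x y < ν) {k : ℕ}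
    {x : Fin n → Pt d} (hocc : ∀ y ∈ T, ∃ a, x a ∈ ball y ν)
    (hcount : ∀ a, x a ∈ C → {j | j ≠ a ∧ dist (x j) (x a) < 4 * ν}.ncard < k) :
    IsLinked C k x := by
  intro S hS a b ha hb
  refine reachable_of_net hν hpre hnear hT hnet hocc hS ?_ a b ha hb
  intro a b hab ha hb hdist
  exact mutualKNN_adj_of_dist_le (fun h => hab (Subtype.ext h)) (hcount a ha) (hcount b hb) hdist

/-- With high probability no point of `C` has `k` sample points at distance less than `r`, if `k`
is at least twice the average number. -/
theorem sampleLaw_exists_crowded_le {d : ℕ} {p : Pt d → ℝ} (hp : IsBoundedDensity p) {n k : ℕ}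
    {C : Set (Pt d)} (hC : MeasurableSet C) {q r : ℝ} (hq : ∀ y ∈ C, (law p).real (ball y r) ≤ q) :
    (sampleLaw p (n + 1)).real {x | ∃ a, x a ∈ C ∧ k ≤ {j | j ≠ a ∧ dist (x j) (x a) < r}.ncard} ≤
      (n + 1) * ((law p).real C * Real.exp (n * q - Real.log 2 * k)) := by
  have := isProbabilityMeasure_law hp
  have hset : {x : Fin (n + 1) → Pt d | ∃ a, x a ∈ C ∧
      k ≤ {j | j ≠ a ∧ dist (x j) (x a) < r}.ncard} = ⋃ a, {x | x a ∈ C ∧ Real.log 2 * k ≤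
        Real.log 2 * ({j | j ≠ a ∧ dist (x j) (x a) < r}.ncard : ℝ)} := by
    ext x
    simp only [mem_ofPred_eq, mem_iUnion]
    refine exists_congr fun a => and_congr_right fun _ => ?_
    rw [mul_le_mul_iff_right₀ (Real.log_pos one_lt_two), Nat.cast_le]
  rw [hset]
  refine (measureReal_iUnion_fintype_le _).trans ?_
  refine (Finset.sum_le_sum fun a _ => pi_mul_neighborCount_ge_le_exp (law p) a hC
    (l := Real.log 2) (c := q) (r := r) (fun y hy => ?_) (Real.log 2 * k)).trans ?_
  · rw [Real.exp_log two_pos]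
    linarith [hq y hy]
  · rw [Finset.sum_const, Finset.card_univ, Fintype.card_fin, nsmul_eq_mul]
    push_cast
    exact le_rfl

theorem sampleLaw_forall_notMem_le {d : ℕ} {p : Pt d → ℝ} (hp : IsBoundedDensity p) {n : ℕ}
    {B : Set (Pt d)} (hB : MeasurableSet B) {c : ℝ} (hc : c ≤ (law p).real B) :
    (sampleLaw p n).real {x | ∀ a, x a ∉ B} ≤ Real.exp (-(n * c)) := by
  have := isProbabilityMeasure_law hp
  have hset : {x : Fin n → Pt d | ∀ a, x a ∉ B} = Set.univ.pi fun _ => Bᶜ := by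
    ext x; simp
  rw [hset, sampleLaw, measureReal_def, Measure.pi_pi, Finset.prod_const, Finset.card_univ,
    Fintype.card_fin, ENNReal.toReal_pow, ← measureReal_def, measureReal_compl hB, probReal_univ,
    ← mul_neg, Real.exp_nat_mul]
  refine pow_le_pow_left₀ (by linarith [measureReal_le_one (μ := law p) (s := B)]) ?_ n
  linarith [Real.add_one_le_exp (-c)]

theorem sampleLaw_exists_empty_le {d : ℕ} {p : Pt d → ℝ} (hp : IsBoundedDensity p) {n : ℕ}
    {T : Finset (Pt d)} {c r : ℝ} (hc : ∀ y ∈ T, c ≤ (law p).real (ball y r)) :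
    (sampleLaw p n).real {x | ∃ y ∈ T, ∀ a, x a ∉ ball y r} ≤ T.card * Real.exp (-(n * c)) := by
  have hset : {x : Fin n → Pt d | ∃ y ∈ T, ∀ a, x a ∉ ball y r} =
      ⋃ y ∈ T, {x | ∀ a, x a ∉ ball y r} := by
    ext x; simp
  have := isProbabilityMeasure_sampleLaw hp n
  rw [hset]
  refine (measureReal_biUnion_finset_le T _).trans ?_
  refine (Finset.sum_le_sum fun y hy =>
    sampleLaw_forall_notMem_le hp measurableSet_ball (hc y hy)).trans ?_
  rw [Finset.sum_const, nsmul_eq_mul]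

theorem exp_neg_one_sub_one_le : Real.exp (-1) - 1 ≤ -(63 / 100) := by
  have h := Real.exp_one_gt_d9
  have h2 : Real.exp (-1) * Real.exp 1 = 1 := by rw [← Real.exp_add]; simp
  nlinarith [Real.exp_pos (-1)]

/-- With high probability the points of a set have at least `k` neighbors at distance less than `u`,
if `k` is small compared with the mass of balls of radius `u`. -/
theorem sampleLaw_exists_sparse_le {d : ℕ} {p : Pt d → ℝ} (hp : IsBoundedDensity p) {n k : ℕ}
    {E : Set (Pt d)} (hE : MeasurableSet E) {u ρ : ℝ}
    (hρ : ∀ y ∈ E, ρ ≤ (law p).real (ball y u)) (hn : 2 ≤ n * ρ)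
    (hk : (k : ℝ) ≤ n * ρ / 2 - 2 * Real.log ((law p).real E * (n + 1))) :
    (sampleLaw p (n + 1)).real {x | ∃ a, x a ∈ E ∧ {j | j ≠ a ∧ dist (x j) (x a) < u}.ncard < k} ≤
      Real.exp (-(n / 2 * (ρ / 2 - (k - 1) / n))) / 2 := by
  have := isProbabilityMeasure_law hp
  have hset : {x : Fin (n + 1) → Pt d | ∃ a, x a ∈ E ∧
      {j | j ≠ a ∧ dist (x j) (x a) < u}.ncard < k} ⊆ ⋃ a, {x | x a ∈ E ∧ -((k : ℝ) - 1) ≤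
        (-1) * ({j | j ≠ a ∧ dist (x j) (x a) < u}.ncard : ℝ)} := by
    rintro x ⟨a, ha, hcard⟩
    refine mem_iUnion.2 ⟨a, ha, ?_⟩
    have : (({j | j ≠ a ∧ dist (x j) (x a) < u}.ncard + 1 : ℕ) : ℝ) ≤ k := Nat.cast_le.2 hcard
    push_cast at this
    linarith
  have := isProbabilityMeasure_sampleLaw hp (n + 1)
  refine (measureReal_mono hset).trans ((measureReal_iUnion_fintype_le _).trans ?_)
  refine (Finset.sum_le_sum fun a _ => pi_mul_neighborCount_ge_le_exp (law p) a hE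
    (l := -1) (c := -(63 / 100) * ρ) (r := u) (fun y hy => ?_) (-((k : ℝ) - 1))).trans ?_
  · have h1 := exp_neg_one_sub_one_le
    have h2 := hρ y hy
    have h3 : 0 ≤ (law p).real (ball y u) := measureReal_nonneg
    nlinarith
  · rw [Finset.sum_const, Finset.card_univ, Fintype.card_fin, nsmul_eq_mul]
    push_cast
    have hn0 : (n : ℝ) ≠ 0 := by rintro h; rw [h] at hn; norm_num at hn
    have h1 : (law p).real E * (n + 1) ≤ Real.exp ((n * ρ / 2 - k) / 2) :=
      (Real.le_exp_log _).trans (Real.exp_le_exp.2 (by linarith))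
    have h2 : Real.exp (-(n / 2 * (ρ / 2 - (k - 1) / n))) / 2 =
        Real.exp (-(n / 2 * (ρ / 2 - (k - 1) / n)) - Real.log 2) := by
      rw [Real.exp_sub, Real.exp_log two_pos]
    rw [h2]
    calc ((n : ℝ) + 1) * ((law p).real E * Real.exp (n * (-(63 / 100) * ρ) - -((k : ℝ) - 1)))
        = ((law p).real E * (n + 1)) * Real.exp (n * (-(63 / 100) * ρ) - -((k : ℝ) - 1)) := by ring
      _ ≤ Real.exp ((n * ρ / 2 - k) / 2) * Real.exp (n * (-(63 / 100) * ρ) - -((k : ℝ) - 1)) := by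
          gcongr
      _ ≤ _ := by
          rw [← Real.exp_add, Real.exp_le_exp]
          have h3 : (n : ℝ) / 2 * (ρ / 2 - (k - 1) / n) = n * ρ / 4 - (k - 1) / 2 := by
            field_simp; ring
          rw [h3]
          linarith [Real.log_two_lt_d9]

/-- The bound for the probability that a cluster is not linked. The radius `4 ν` at which sample
points are joined is chosen such that a ball of this radius contains at most `(k - 1) / 2` sample
points on average. -/
theorem sampleLaw_not_isLinked_le {d : ℕ} (hd : 0 < d) {p : Pt d → ℝ} (hp : IsBoundedDensity p)
    {t : ℝ} (ht : 0 < t) {C E : Set (Pt d)} (hC : IsCompact C) (hconn : IsConnected C)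
    (hfr : IsC2Hypersurface (frontier C)) (hκ : 0 < curvatureRadius C)
    (htC : ∀ᵐ x, x ∈ C → t ≤ p x) {u ρ : ℝ} (hu : 0 < u)
    (hloc : ∀ x ∈ C, ∀ y, dist x y < u → p y ≤ maxDensity p C)
    (hρ : ∀ x ∈ C, ρ ≤ (law p).real (ball x u)) {n k : ℕ} (hn : 0 < n) (hk : 5 ≤ k)
    (hlog : 0 ≤ Real.log ((law p).real E * (n + 1 : ℕ)))
    (hcond : Condition1 p t C E u ρ (n + 1) k) :
    (sampleLaw p (n + 1)).real {x | ¬ IsLinked C k x} ≤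
      Real.exp (-connectionExponent d (maxDensity p C) t k) := by
  have hfne := frontier_nonempty_of_isCompact hd hC hconn.nonempty
  have hvol := volume_real_pos_of_curvatureRadius_pos hd hC hconn.nonempty hκ
  have htpm := le_maxDensity_of_ae hp hvol htC
  set pm := maxDensity p C with hpm
  set V := (volume : Measure (Pt d)).real C with hV
  set η := unitBallVolume d with hη
  have hη0 : 0 < η := unitBallVolume_pos d
  have hpm0 : 0 < pm := ht.trans_le htpm
  have hn0 : (0 : ℝ) < n := Nat.cast_pos.2 hn
  have hk5 : (5 : ℝ) ≤ k := by exact_mod_cast hk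
  obtain ⟨hc1, hc2⟩ := hcond
  push_cast at hc1 hc2 hlog
  rw [add_sub_cancel_right] at hc2
  rw [← hpm, ← hη] at hc2
  rw [← hpm, ← hV] at hc1
  -- The radius of the balls of the net.
  obtain ⟨ν, hν0, hνd⟩ : ∃ ν : ℝ, 0 < ν ∧ ν ^ d = (k - 1) / (2 * 4 ^ d * n * pm * η) := by
    have h1 : (0 : ℝ) < (k - 1) / (2 * 4 ^ d * n * pm * η) := by
      have : (0 : ℝ) < k - 1 := by linarith
      positivity
    exact ⟨((k - 1) / (2 * 4 ^ d * n * pm * η)) ^ ((d : ℝ)⁻¹), Real.rpow_pos_of_pos h1 _,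
      Real.rpow_inv_natCast_pow h1.le hd.ne'⟩
  have hνη : ν ^ d * η * (2 * 4 ^ d * n * pm) = k - 1 := by
    rw [hνd]; field_simp
  -- It is below the covering radius, and the balls of four times this radius stay within
  -- the distance `u`.
  have hmin1 : (k : ℝ) ≤ n * ρ / 2 := by
    have h1 : (k : ℝ) ≤ n * (ρ / 2 - 2 * Real.log ((law p).real E * (n + 1)) / n) :=
      hc2.trans (mul_le_mul_of_nonneg_left (min_le_left _ _) hn0.le)
    have h2 : (n : ℝ) * (ρ / 2 - 2 * Real.log ((law p).real E * (n + 1)) / n) =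
        n * ρ / 2 - 2 * Real.log ((law p).real E * (n + 1)) := by field_simp
    linarith
  have hmin2 : (k : ℝ) ≤ n * (2 * 4 ^ d * η * pm * coveringRadius C ^ d) :=
    hc2.trans (mul_le_mul_of_nonneg_left ((min_le_right _ _).trans
      (mul_le_mul_of_nonneg_left (min_le_right _ _) (by positivity))) hn0.le)
  have hνcov : ν < coveringRadius C := by
    refine lt_of_pow_lt_pow_left₀ d (Real.sSup_nonneg fun _ h => h.1) ?_
    rw [hνd, div_lt_iff₀ (by positivity)]
    calc (k : ℝ) - 1 < k := by linarith
      _ ≤ _ := hmin2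
      _ = _ := by ring
  have hνκ : ν < curvatureRadius C :=
    hνcov.trans_le (coveringRadius_le_curvatureRadius C hκ.le)
  have hνu : 4 * ν ≤ u := by
    obtain ⟨x, hx⟩ := hconn.nonempty
    have h1 : ρ ≤ pm * (u ^ d * η) := by
      refine (hρ x hx).trans ?_
      rw [hη, ← volume_real_ball x hu]
      refine law_real_le measurableSet_ball measure_ball_lt_top.ne hpm0.le fun y hy => ?_
      rw [mem_ball, dist_comm] at hy
      exact hloc x hx y hy
    refine le_of_lt (lt_of_pow_lt_pow_left₀ d hu.le ?_)
    have h2 : (n : ℝ) * ρ ≤ n * (pm * (u ^ d * η)) := by gcongr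
    have h3 : (4 * ν) ^ d * (2 * n * pm * η) < u ^ d * (2 * n * pm * η) := by
      have : (4 * ν) ^ d * (2 * n * pm * η) = k - 1 := by rw [mul_pow, ← hνη]; ring
      rw [this]
      nlinarith
    exact lt_of_mul_lt_mul_right h3 (by positivity)
  have hroll := fun q (hq : q ∈ frontier C) =>
    exists_touching_ball_of_lt_curvatureRadius hν0 hνκ hq
  obtain ⟨T, hT, hnet, hcard⟩ := exists_finite_net hC hν0
  set b := connectionExponent d pm t k with hb
  have hτ : t / pm / 4 ^ (d + 1) ≤ 1 / 16 := by
    have h1 : t / pm ≤ 1 := (div_le_one hpm0).2 htpm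
    have h2 : (16 : ℝ) ≤ 4 ^ (d + 1) := by
      calc (16 : ℝ) = 4 ^ 2 := by norm_num
        _ ≤ 4 ^ (d + 1) := by exact pow_le_pow_right₀ (by norm_num) (by omega)
    exact div_le_div₀ zero_le_one h1 (by norm_num) h2
  have hb' : b = (k - 1) * (t / pm / 4 ^ (d + 1)) := by
    rw [hb, connectionExponent]; ring
  have hbk : b ≤ (k - 1) / 16 := by
    rw [hb']; nlinarith
  -- The lower bound on `k` controls the number of points and of net balls by `exp b`.
  have hexp : 2 * 8 ^ d * pm * V * (n + 1) ≤ Real.exp (b + 1 / 16) := by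
    refine (Real.le_exp_log _).trans (Real.exp_le_exp.2 ?_)
    have h1 : Real.log (2 * 8 ^ d * pm * V * (n + 1)) ≤ k * (t / pm / 4 ^ (d + 1)) := by
      have h2 : k * (t / pm / 4 ^ (d + 1)) = k / (4 ^ (d + 1) * (pm / t)) := by
        field_simp
      rw [h2, le_div_iff₀ (by positivity)]
      linarith
    rw [hb']
    linarith
  have hcrowd := sampleLaw_exists_crowded_le hp (n := n) (k := k) hC.measurableSet
    (q := (k - 1) / (2 * n)) (r := 4 * ν) (fun y hy => by
      have h1 := law_real_le (p := p) (B := ball y (4 * ν)) measurableSet_ball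
        measure_ball_lt_top.ne hpm0.le (fun w hw => hloc y hy w (by
          rw [mem_ball, dist_comm] at hw
          linarith))
      rw [volume_real_ball y (by positivity), ← hη] at h1
      refine h1.trans (le_of_eq ?_)
      rw [← hνη, mul_pow]
      field_simp)
  have hempty := sampleLaw_exists_empty_le hp (n := n + 1) (T := T) (r := ν)
    (c := t * (ν ^ d * η)) (fun y hy => by
      rw [hη, ← volume_real_ball y hν0]
      refine le_law_real hp measurableSet_ball ?_
      filter_upwards [htC] with x hx hxB
      exact hx (hT y hy (ball_subset_closedBall hxB)))
  have := isProbabilityMeasure_sampleLaw hp (n + 1)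
  have hsub : {x : Fin (n + 1) → Pt d | ¬ IsLinked C k x} ⊆
      {x | ∃ a, x a ∈ C ∧ k ≤ {j | j ≠ a ∧ dist (x j) (x a) < 4 * ν}.ncard} ∪
      {x | ∃ y ∈ T, ∀ a, x a ∉ ball y ν} := by
    intro x hx
    by_contra hcon
    simp only [mem_union, mem_ofPred_eq, not_or, not_exists, not_and, not_le, not_forall,
      not_not] at hcon
    refine hx (isLinked_of_net hν0
      (isPreconnected_innerSet hC hconn.isPreconnected hfr hfne hν0 hroll)
      (fun y hy => exists_mem_innerSet_dist_le hC.isClosed hfr hfne hν0 hroll hy) hT hnet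
      (fun y hy => hcon.2 y hy) hcon.1)
  refine (measureReal_mono hsub).trans ((measureReal_union_le _ _).trans ?_)
  have hhalf : Real.exp (-b) = Real.exp (-b) / 2 + Real.exp (-b) / 2 := by ring
  rw [hhalf]
  refine add_le_add (hcrowd.trans ?_) (hempty.trans ?_)
  · have h1 : ((n : ℝ) + 1) * (law p).real C ≤ Real.exp (b + 1 / 16) / 2 := by
      have h2 := law_real_le (p := p) hC.measurableSet hC.measure_lt_top.ne hpm0.le
        (fun x hx => le_maxDensity hp hx)
      have h8 : (1 : ℝ) ≤ 8 ^ d := one_le_pow₀ (by norm_num)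
      have h3 : ((n : ℝ) + 1) * (law p).real C ≤ (n + 1) * (pm * V) := by gcongr
      have h4 : (n + 1) * (pm * V) ≤ 8 ^ d * ((n + 1) * (pm * V)) :=
        le_mul_of_one_le_left (by positivity) h8
      linarith
    calc ((n : ℝ) + 1) * ((law p).real C * Real.exp (n * ((k - 1) / (2 * n)) - Real.log 2 * k))
        = ((n + 1) * (law p).real C) * Real.exp ((k - 1) / 2 - Real.log 2 * k) := by
          rw [show (n : ℝ) * ((k - 1) / (2 * n)) = (k - 1) / 2 by field_simp]; ring
      _ ≤ Real.exp (b + 1 / 16) / 2 * Real.exp ((k - 1) / 2 - Real.log 2 * k) := by gcongr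
      _ = Real.exp (b + 1 / 16 + ((k - 1) / 2 - Real.log 2 * k)) / 2 := by
          rw [Real.exp_add (b + 1 / 16)]; ring
      _ ≤ Real.exp (-b) / 2 := by
          gcongr
          nlinarith [Real.log_two_gt_d9]
  · have h1 : (T.card : ℝ) * (k - 1) ≤ Real.exp (b + 1 / 16) := by
      refine le_trans ?_ hexp
      have h2 : (T.card : ℝ) * (k - 1) =
          (T.card * ((ν / 2) ^ d * η)) * (2 * 8 ^ d * n * pm) := by
        rw [← hνη, div_pow, show (8 : ℝ) ^ d = 2 ^ d * 4 ^ d by rw [← mul_pow]; norm_num]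
        field_simp
      rw [h2]
      calc (T.card * ((ν / 2) ^ d * η)) * (2 * 8 ^ d * n * pm) ≤ V * (2 * 8 ^ d * n * pm) := by
            gcongr
        _ ≤ V * (2 * 8 ^ d * (n + 1) * pm) := by gcongr; linarith
        _ = _ := by ring
    have h2 : Real.exp (1 / 16) ≤ 2 := by
      have : Real.exp (1 / 16) ≤ Real.exp (Real.log 2) :=
        Real.exp_le_exp.2 (by linarith [Real.log_two_gt_d9])
      rwa [Real.exp_log two_pos] at this
    have h3 : (T.card : ℝ) ≤ Real.exp b / 2 := by
      rw [Real.exp_add] at h1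
      have h4 : (T.card : ℝ) * 4 ≤ T.card * (k - 1) := by gcongr; linarith
      have h5 : Real.exp b * Real.exp (1 / 16) ≤ Real.exp b * 2 := by gcongr
      linarith
    have h4 : 2 * b ≤ ((n + 1 : ℕ) : ℝ) * (t * (ν ^ d * η)) := by
      have h5 : 2 * b = n * (t * (ν ^ d * η)) := by
        rw [hb', ← hνη, pow_succ]; field_simp; ring
      rw [h5]
      push_cast
      gcongr
      linarith
    calc (T.card : ℝ) * Real.exp (-(((n + 1 : ℕ) : ℝ) * (t * (ν ^ d * η))))
        ≤ Real.exp b / 2 * Real.exp (-(2 * b)) := by gcongr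
      _ = Real.exp (-b) / 2 := by
          rw [div_mul_eq_mul_div, ← Real.exp_add]; ring_nf

/-! ### Clusters and enlarged clusters -/

theorem IsClusters.exists_eq {d m : ℕ} {p : Pt d → ℝ} {t : ℝ} {C : Fin m → Set (Pt d)}
    (h : IsClusters p t C) (i : Fin m) :
    ∃ x ∈ levelSet p t, C i = connectedComponentIn (levelSet p t) x := by
  have : C i ∈ range C := mem_range_self i
  rw [h.range_eq] at this
  exact this

theorem IsClusters.isConnected {d m : ℕ} {p : Pt d → ℝ} {t : ℝ} {C : Fin m → Set (Pt d)}
    (h : IsClusters p t C) (i : Fin m) : IsConnected (C i) := by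
  obtain ⟨x, hx, hC⟩ := h.exists_eq i
  rw [hC]
  exact isConnected_connectedComponentIn_iff.2 hx

theorem IsClusters.subset_levelSet {d m : ℕ} {p : Pt d → ℝ} {t : ℝ} {C : Fin m → Set (Pt d)}
    (h : IsClusters p t C) (i : Fin m) : C i ⊆ levelSet p t := by
  obtain ⟨x, hx, hC⟩ := h.exists_eq i
  rw [hC]
  exact connectedComponentIn_subset _ _

theorem IsClusters.exists_mem {d m : ℕ} {p : Pt d → ℝ} {t : ℝ} {C : Fin m → Set (Pt d)}
    (h : IsClusters p t C) {x : Pt d} (hx : x ∈ levelSet p t) : ∃ i, x ∈ C i := by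
  have : connectedComponentIn (levelSet p t) x ∈ range C := by
    rw [h.range_eq]
    exact ⟨x, hx, rfl⟩
  obtain ⟨i, hi⟩ := this
  exact ⟨i, hi ▸ mem_connectedComponentIn hx⟩

theorem levelSet_anti {d : ℕ} {p : Pt d → ℝ} {s t : ℝ} (h : s ≤ t) :
    levelSet p t ⊆ levelSet p s :=
  closure_mono fun _ hx => h.trans hx

theorem subset_enlarge {d : ℕ} {p : Pt d → ℝ} {t s : ℝ} {C : Set (Pt d)} (hs : 0 ≤ s)
    (hC : C ⊆ levelSet p t) : C ⊆ enlarge p t s C := fun _ hx =>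
  mem_biUnion hx (mem_connectedComponentIn (levelSet_anti (by linarith) (hC hx)))

theorem enlarge_subset_enlarge {d : ℕ} {p : Pt d → ℝ} {t s s' : ℝ} {C : Set (Pt d)}
    (hs : s ≤ s') : enlarge p t s C ⊆ enlarge p t s' C :=
  biUnion_mono subset_rfl fun x _ => connectedComponentIn_mono x (levelSet_anti (by linarith))

theorem enlarge_eq_connectedComponentIn {d : ℕ} {p : Pt d → ℝ} {t s : ℝ} {C : Set (Pt d)}
    (hs : 0 ≤ s) (hC : C ⊆ levelSet p t) (hconn : IsPreconnected C) {x : Pt d} (hx : x ∈ C) :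
    enlarge p t s C = connectedComponentIn (levelSet p (t - s)) x := by
  have hC' : C ⊆ levelSet p (t - s) := hC.trans (levelSet_anti (by linarith))
  refine Subset.antisymm (iUnion₂_subset fun y hy => ?_) (subset_biUnion_of_mem hx)
  have h1 : x ∈ connectedComponentIn (levelSet p (t - s)) y :=
    hconn.subset_connectedComponentIn hy hC' hx
  rw [connectedComponentIn_eq h1]

theorem isClosed_connectedComponentIn {X : Type*} [TopologicalSpace X] {F : Set X}
    (hF : IsClosed F) {x : X} (hx : x ∈ F) : IsClosed (connectedComponentIn F x) := by
  refine isClosed_of_closure_subset ?_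
  exact (isPreconnected_connectedComponentIn.closure).subset_connectedComponentIn
    (subset_closure (mem_connectedComponentIn hx))
    (hF.closure_subset_iff.2 (connectedComponentIn_subset F x))

theorem IsClusters.isClosed_enlarge {d m : ℕ} {p : Pt d → ℝ} {t : ℝ} {C : Fin m → Set (Pt d)}
    (h : IsClusters p t C) {s : ℝ} (hs : 0 ≤ s) (i : Fin m) : IsClosed (enlarge p t s (C i)) := by
  obtain ⟨x, hx⟩ := (h.isConnected i).nonempty
  rw [enlarge_eq_connectedComponentIn hs (h.subset_levelSet i) (h.isConnected i).isPreconnected hx]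
  exact isClosed_connectedComponentIn isClosed_closure
    (levelSet_anti (by linarith) (h.subset_levelSet i hx))

/-- Near a cluster the density does not exceed its maximum in the cluster: the other
clusters are too far away, and outside of the clusters the density is less than `t`. -/
theorem le_maxDensity_of_dist_lt {d m : ℕ} {p : Pt d → ℝ} (hp : IsBoundedDensity p) {t : ℝ}
    {C E : Fin m → Set (Pt d)} {u ρ : Fin m → ℝ} (hC : IsClusters p t C)
    (hCE : ∀ i, C i ⊆ E i) (hsep : IsSeparated p E u ρ) {i : Fin m} (ht : t ≤ maxDensity p (C i))
    {x y : Pt d} (hx : x ∈ C i) (hxy : dist x y < u i) : p y ≤ maxDensity p (C i) := by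
  rcases lt_or_ge (p y) t with h | h
  · exact h.le.trans ht
  · obtain ⟨j, hj⟩ := hC.exists_mem (subset_closure h : y ∈ levelSet p t)
    by_cases hij : i = j
    · exact le_maxDensity hp (hij ▸ hj)
    · exact absurd hxy (not_lt.2 (hsep.le_dist i j hij x (hCE i hx) y (hCE j hj)))

/-! ### Linked clusters and isolated enlarged clusters -/

/-- All edges at sample points of `E` are shorter than `u`. -/
def IsIsolated {d n : ℕ} (E : Set (Pt d)) (u : ℝ) (k : ℕ) (x : Fin n → Pt d) : Prop :=
  ∀ a b, x a ∈ E → (mutualKNN k x).Adj a b → dist (x a) (x b) < u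

theorem isIsolated_of_le_ncard {d n : ℕ} {E : Set (Pt d)} {u : ℝ} {k : ℕ} {x : Fin n → Pt d}
    (h : ∀ a, x a ∈ E → k ≤ {j | j ≠ a ∧ dist (x j) (x a) < u}.ncard) : IsIsolated E u k x := by
  intro a b ha hab
  by_contra! hu
  have h1 : {l | l ≠ a ∧ dist (x l) (x a) < dist (x b) (x a)}.ncard < k := hab.2.2
  have h2 : {j | j ≠ a ∧ dist (x j) (x a) < u}.ncard ≤
      {l | l ≠ a ∧ dist (x l) (x a) < dist (x b) (x a)}.ncard := by
    refine Set.ncard_le_ncard ?_ (Set.toFinite _)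
    rintro j ⟨hj, hj2⟩
    refine ⟨hj, hj2.trans_le ?_⟩
    rwa [dist_comm (x b)]
  exact absurd (h a ha) (by omega)

theorem isolationExponent_mono {ρ ρ' : ℝ} (h : ρ ≤ ρ') {n : ℕ} (hn : 1 ≤ n) (k : ℝ) :
    isolationExponent ρ n k ≤ isolationExponent ρ' n k := by
  have : (1 : ℝ) ≤ n := by exact_mod_cast hn
  have : 0 ≤ ((n : ℝ) - 1) / 2 := by linarith
  unfold isolationExponent
  gcongr

theorem connectionExponent_anti {d : ℕ} {P P' t k : ℝ} (hP : 0 < P) (h : P ≤ P') (ht : 0 < t)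
    (hk : 1 ≤ k) : connectionExponent d P' t k ≤ connectionExponent d P t k := by
  unfold connectionExponent
  have : 0 ≤ k - 1 := by linarith
  gcongr

/-- The sample size from which on the bounds hold depends on the clusters only: it makes the
logarithms in the conditions on `k` nonnegative and `k` at least five. -/
theorem eventually_large_sample {V P μE ρ c : ℝ} (hV : 0 < V) (hP : 0 < P) (hE : 0 < μE)
    (hρ : 0 < ρ) (hc : 0 < c) :
    ∀ᶠ n : ℕ in atTop, 2 ≤ n ∧ 1 ≤ Real.log (c * P * V * n) ∧ 0 ≤ Real.log (μE * n) ∧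
      2 ≤ ((n : ℝ) - 1) * ρ := by
  have hn : Tendsto (fun n : ℕ => (n : ℝ)) atTop atTop := tendsto_natCast_atTop_atTop
  refine (eventually_ge_atTop 2).and (Eventually.and ?_ (Eventually.and ?_ ?_))
  · exact (Real.tendsto_log_atTop.comp (hn.const_mul_atTop (by positivity))).eventually_ge_atTop 1
  · exact (Real.tendsto_log_atTop.comp (hn.const_mul_atTop hE)).eventually_ge_atTop 0
  · exact ((tendsto_atTop_add_const_right _ (-1 : ℝ) hn).atTop_mul_const hρ).eventually_ge_atTop 2

theorem five_le_of_condition1 {d : ℕ} (hd : 0 < d) {p : Pt d → ℝ} {t : ℝ} (ht : 0 < t) {C E : Set (Pt d)}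
    {u ρ : ℝ} {n k : ℕ} (htp : t ≤ maxDensity p C)
    (hlog : 1 ≤ Real.log (2 * 8 ^ d * maxDensity p C * (volume : Measure (Pt d)).real C * n))
    (h : Condition1 p t C E u ρ n k) : 5 ≤ k := by
  have h1 : 1 ≤ maxDensity p C / t := (one_le_div ht).2 htp
  have h2 : (4 : ℝ) ^ 2 ≤ 4 ^ (d + 1) := pow_le_pow_right₀ (by norm_num) (by omega)
  have h3 : (4 : ℝ) ^ 2 * 1 * 1 ≤ k := le_trans (by gcongr) h.1
  exact_mod_cast (by linarith : (5 : ℝ) ≤ k)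

/-- Both parts of the bad event, for all clusters together. The factor `1 / 2` compensates for
rounding `k` to an integer. -/
theorem eventually_sampleLaw_not_linked_isolated_le {d m : ℕ} (hd : 0 < d) {p : Pt d → ℝ}
    (hp : IsBoundedDensity p) {t : ℝ} (ht : 0 < t) {C E : Fin m → Set (Pt d)} {u ρ : Fin m → ℝ}
    (hC : IsClusters p t C) (hCE : ∀ i, C i ⊆ E i) (hE : ∀ i, IsClosed (E i))
    (hsep : IsSeparated p E u ρ) (htC : ∀ᵐ x, x ∈ levelSet p t → t ≤ p x) :
    ∀ᶠ n : ℕ in atTop, ∀ k : ℕ, (∀ i, Condition1 p t (C i) (E i) (u i) (ρ i) n k) →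
      (sampleLaw p n).real
        {x | ¬ ∀ i, IsLinked (C i) k x ∧ IsIsolated (E i) (u i) k x} ≤
      (m * Real.exp (-isolationExponent (⨅ i, ρ i) n k)
        + 2 * m * Real.exp (-connectionExponent d (⨆ i, maxDensity p (C i)) t k)) / 2 := by
  have := isProbabilityMeasure_law hp
  have htCi : ∀ i, ∀ᵐ x, x ∈ C i → t ≤ p x := fun i => by
    filter_upwards [htC] with x hx hxC using hx (hC.subset_levelSet i hxC)
  have hvol : ∀ i, 0 < (volume : Measure (Pt d)).real (C i) := fun i =>
    volume_real_pos_of_curvatureRadius_pos hd (hC.isCompact i) (hC.isConnected i).nonempty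
      (hC.curvatureRadius_pos i)
  have htp : ∀ i, t ≤ maxDensity p (C i) := fun i => le_maxDensity_of_ae hp (hvol i) (htCi i)
  have hμE : ∀ i, 0 < (law p).real (E i) := fun i =>
    (mul_pos ht (hvol i)).trans_le ((le_law_real hp (hC.isCompact i).measurableSet
      (htCi i)).trans (measureReal_mono (hCE i)))
  have hlarge : ∀ᶠ n : ℕ in atTop, ∀ i, _ := eventually_all.2 fun i =>
    eventually_large_sample (c := 2 * 8 ^ d) (hvol i) (ht.trans_le (htp i)) (hμE i) (hsep.rho_pos i)
      (by positivity)
  filter_upwards [hlarge, eventually_ge_atTop 1] with n hn hn1 k hcond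
  obtain ⟨N, rfl⟩ : ∃ N, n = N + 1 := ⟨n - 1, by omega⟩
  have := isProbabilityMeasure_sampleLaw hp (N + 1)
  have hsub : {x : Fin (N + 1) → Pt d | ¬ ∀ i, IsLinked (C i) k x ∧ IsIsolated (E i) (u i) k x} ⊆
      ⋃ i, ({x | ¬ IsLinked (C i) k x} ∪
        {x | ∃ a, x a ∈ E i ∧ {j | j ≠ a ∧ dist (x j) (x a) < u i}.ncard < k}) := by
    intro x hx
    obtain ⟨i, hi⟩ := not_forall.1 hx
    refine mem_iUnion.2 ⟨i, ?_⟩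
    rcases not_and_or.1 hi with h | h
    · exact Or.inl h
    · refine Or.inr ?_
      by_contra hcon
      simp only [mem_ofPred_eq, not_exists, not_and, not_lt] at hcon
      exact h (isIsolated_of_le_ncard hcon)
  refine (measureReal_mono hsub).trans ((measureReal_iUnion_fintype_le _).trans ?_)
  have hterm : ∀ i : Fin m, (sampleLaw p (N + 1)).real ({x | ¬ IsLinked (C i) k x} ∪
        {x | ∃ a, x a ∈ E i ∧ {j | j ≠ a ∧ dist (x j) (x a) < u i}.ncard < k}) ≤
      Real.exp (-connectionExponent d (⨆ i, maxDensity p (C i)) t k) +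
        Real.exp (-isolationExponent (⨅ i, ρ i) (N + 1) k) / 2 := by
    intro i
    obtain ⟨h2, hlog1, hlog2, hNρ⟩ := hn i
    have hk5 : 5 ≤ k := five_le_of_condition1 hd ht (htp i) hlog1 (hcond i)
    have hk1 : (1 : ℝ) ≤ k := by exact_mod_cast (by omega : 1 ≤ k)
    refine (measureReal_union_le _ _).trans (add_le_add ?_ ?_)
    · refine (sampleLaw_not_isLinked_le hd hp ht (hC.isCompact i) (hC.isConnected i)
        (hC.boundary i) (hC.curvatureRadius_pos i) (htCi i) (hsep.u_pos i)
        (fun x hx y hxy => le_maxDensity_of_dist_lt hp hC hCE hsep (htp i) hx hxy)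
        (fun x hx => hsep.le_mass i x (hCE i hx)) (by omega) hk5 hlog2 (hcond i)).trans ?_
      rw [Real.exp_le_exp, neg_le_neg_iff]
      exact connectionExponent_anti (ht.trans_le (htp i))
        (le_ciSup (f := fun i => maxDensity p (C i)) (finite_range _).bddAbove i) ht hk1
    · push_cast at hNρ
      rw [add_sub_cancel_right] at hNρ
      have hN0 : (0 : ℝ) < N := by exact_mod_cast (by omega : 0 < N)
      have hk := (hcond i).2.trans (mul_le_mul_of_nonneg_left (min_le_left _ _)
        (by push_cast; linarith))
      push_cast at hk
      rw [add_sub_cancel_right] at hk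
      refine (sampleLaw_exists_sparse_le hp (hE i).measurableSet (hsep.le_mass i) hNρ ?_).trans ?_
      · refine hk.trans (le_of_eq ?_)
        field_simp
      · have h3 := isolationExponent_mono (ciInf_le (finite_range ρ).bddBelow i)
          (Nat.succ_pos N) (k : ℝ)
        have h4 : isolationExponent (ρ i) (N + 1) k = N / 2 * (ρ i / 2 - (k - 1) / N) := by
          unfold isolationExponent
          push_cast
          rw [add_sub_cancel_right]
        rw [← h4]
        gcongr
  refine (Finset.sum_le_sum fun i _ => hterm i).trans (le_of_eq ?_)
  rw [Finset.sum_const, Finset.card_univ, Fintype.card_fin, nsmul_eq_mul]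
  ring

/-! ### The optimal number of neighbors -/

theorem isolationExponent_eq {d n : ℕ} {ρ P t : ℝ} (hP : 0 < P) (ht : 0 < t) (hn : 2 ≤ n) (k : ℝ) :
    isolationExponent ρ n k =
      ((n : ℝ) - 1) * rateNoiseFree d ρ P t - (k - optimalK d ρ P t n) / 2 := by
  have hn' : (0 : ℝ) < n - 1 := by
    have : (2 : ℝ) ≤ n := by exact_mod_cast hn
    linarith
  unfold isolationExponent rateNoiseFree optimalK
  have h1 : (2 : ℝ) * 4 ^ (d + 1) * (P / t) + 4 ≠ 0 := by positivity
  have h2 : (2 : ℝ) + 1 / 4 ^ d * (t / P) ≠ 0 := by positivity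
  rw [pow_succ] at *
  field_simp
  ring

theorem connectionExponent_eq {d n : ℕ} {ρ P t : ℝ} (hP : 0 < P) (ht : 0 < t) (k : ℝ) :
    connectionExponent d P t k =
      ((n : ℝ) - 1) * rateNoiseFree d ρ P t
        + (k - optimalK d ρ P t n) * (t / P / 4 ^ (d + 1)) := by
  unfold connectionExponent rateNoiseFree optimalK
  have h1 : (2 : ℝ) * 4 ^ (d + 1) * (P / t) + 4 ≠ 0 := by positivity
  have h2 : (2 : ℝ) + 1 / 4 ^ d * (t / P) ≠ 0 := by positivity
  rw [pow_succ] at *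
  field_simp
  ring

theorem exponentNoiseFree_optimalK {d n : ℕ} {ρ P t : ℝ} (hP : 0 < P) (ht : 0 < t) (hn : 2 ≤ n) :
    exponentNoiseFree d ρ P t n (optimalK d ρ P t n) = ((n : ℝ) - 1) * rateNoiseFree d ρ P t := by
  rw [exponentNoiseFree, isolationExponent_eq (d := d) hP ht hn,
    connectionExponent_eq (n := n) (ρ := ρ) hP ht]
  simp

theorem exponentNoiseFree_lt {d n : ℕ} {ρ P t : ℝ} (hP : 0 < P) (ht : 0 < t) (hn : 2 ≤ n) {k : ℝ}
    (hk : k ≠ optimalK d ρ P t n) :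
    exponentNoiseFree d ρ P t n k < exponentNoiseFree d ρ P t n (optimalK d ρ P t n) := by
  rw [exponentNoiseFree_optimalK hP ht hn, exponentNoiseFree,
    isolationExponent_eq (d := d) hP ht hn, connectionExponent_eq (n := n) (ρ := ρ) hP ht]
  rcases lt_or_gt_of_ne hk with h | h
  · have : (k - optimalK d ρ P t n) * (t / P / 4 ^ (d + 1)) < 0 :=
      mul_neg_of_neg_of_pos (by linarith) (by positivity)
    exact (min_le_right _ _).trans_lt (by linarith)
  · exact (min_le_left _ _).trans_lt (by linarith)

/-- Rounding the optimal number of neighbors to an integer decreases the exponent by at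
most `1 / 2`. -/
theorem sub_half_le_exponentNoiseFree {d n : ℕ} {ρ P t : ℝ} (ht : 0 < t) (htP : t ≤ P)
    (hn : 2 ≤ n) {k : ℝ} (hk : |k - optimalK d ρ P t n| < 1) :
    ((n : ℝ) - 1) * rateNoiseFree d ρ P t - 1 / 2 ≤ exponentNoiseFree d ρ P t n k := by
  have hP : 0 < P := ht.trans_le htP
  rw [exponentNoiseFree, isolationExponent_eq (d := d) hP ht hn,
    connectionExponent_eq (n := n) (ρ := ρ) hP ht]
  obtain ⟨h1, h2⟩ := abs_lt.1 hk
  refine le_min (by linarith) ?_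
  have h3 : t / P ≤ 1 := (div_le_one hP).2 htP
  have h4 : (4 : ℝ) ≤ 4 ^ (d + 1) := le_self_pow₀ (by norm_num) (by omega)
  have h5 : t / P / 4 ^ (d + 1) ≤ 1 / 4 := div_le_div₀ zero_le_one h3 (by norm_num) h4
  have h6 : 0 < t / P / 4 ^ (d + 1) := by positivity
  nlinarith

theorem exp_half_le_two : Real.exp (1 / 2) ≤ 2 := by
  have : Real.exp (1 / 2) ≤ Real.exp (Real.log 2) :=
    Real.exp_le_exp.2 (by linarith [Real.log_two_gt_d9])
  rwa [Real.exp_log two_pos] at this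

theorem exp_neg_le_two_mul {a b : ℝ} (h : b - 1 / 2 ≤ a) :
    Real.exp (-a) ≤ 2 * Real.exp (-b) := by
  calc Real.exp (-a) ≤ Real.exp (1 / 2 + -b) := Real.exp_le_exp.2 (by linarith)
    _ = Real.exp (1 / 2) * Real.exp (-b) := Real.exp_add _ _
    _ ≤ 2 * Real.exp (-b) := by gcongr; exact exp_half_le_two

theorem half_sum_exp_le {d n : ℕ} {ρ P t : ℝ} (ht : 0 < t) (htP : t ≤ P) (hn : 2 ≤ n) {k : ℝ}
    (hk : |k - optimalK d ρ P t n| < 1) (m : ℕ) :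
    (m * Real.exp (-isolationExponent ρ n k) + 2 * m * Real.exp (-connectionExponent d P t k)) / 2
      ≤ 3 * m * Real.exp (-(((n : ℝ) - 1) * rateNoiseFree d ρ P t)) := by
  have h := sub_half_le_exponentNoiseFree ht htP hn hk
  have h1 := exp_neg_le_two_mul (h.trans (min_le_left _ _))
  have h2 := exp_neg_le_two_mul (h.trans (min_le_right _ _))
  have h3 := mul_le_mul_of_nonneg_left h1 (Nat.cast_nonneg (α := ℝ) m)
  have h4 := mul_le_mul_of_nonneg_left h2 (Nat.cast_nonneg (α := ℝ) m)
  linarith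

/-! ### The noise-free case -/

theorem isIdentified_of_linked_isolated {d m n k : ℕ} {p : Pt d → ℝ} {C : Fin m → Set (Pt d)}
    {u ρ : Fin m → ℝ} (hsep : IsSeparated p C u ρ) {x : Fin n → Pt d}
    (hmem : ∀ a, ∃ i, x a ∈ C i)
    (h : ∀ i, IsLinked (C i) k x ∧ IsIsolated (C i) (u i) k x) (i : Fin m) :
    IsIdentified C x (mutualKNN k x) i := by
  refine ⟨fun a b ha hb => (h i).1.reachable ha hb, fun j hj a b ha hb hab => ?_⟩
  have hstay : ∀ a c, x a ∈ C i → (mutualKNN k x).Reachable a c → x c ∈ C i := by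
    rintro a c ha ⟨w⟩
    induction w with
    | nil => exact ha
    | @cons a e c hae w ih =>
      obtain ⟨l, hl⟩ := hmem e
      by_cases hil : i = l
      · exact ih (hil ▸ hl)
      · exact absurd ((h i).2 a e ha hae) (not_lt.2 (hsep.le_dist i l hil _ ha _ hl))
  have hbi := hstay a b ha hab
  have := hsep.le_dist i j hj.symm _ hbi _ hb
  rw [dist_self] at this
  exact absurd this (not_le.2 (hsep.u_pos i))

theorem sampleLaw_exists_notMem_levelSet {d : ℕ} {p : Pt d → ℝ} (hp : IsBoundedDensity p) {t : ℝ}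
    (hnf : IsNoiseFree p t) (n : ℕ) :
    (sampleLaw p n).real {x | ∃ a, x a ∉ levelSet p t} = 0 := by
  have := isProbabilityMeasure_law hp
  have hm : MeasurableSet (levelSet p t)ᶜ := isClosed_closure.measurableSet.compl
  have h0 : law p (levelSet p t)ᶜ = 0 := by
    rw [law, withDensity_apply _ hm]
    refine (lintegral_eq_zero_iff hp.measurable.ennreal_ofReal).2 ?_
    rw [Filter.EventuallyEq, ae_restrict_iff' hm]
    filter_upwards [hnf] with x hx hxL
    simp [hx.2 hxL]
  have hset : {x : Fin n → Pt d | ∃ a, x a ∉ levelSet p t} =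
      ⋃ a, Function.eval a ⁻¹' (levelSet p t)ᶜ := by
    ext x; simp
  rw [hset, measureReal_def, ENNReal.toReal_eq_zero_iff]
  left
  refine measure_iUnion_null fun a => ?_
  exact (Measure.quasiMeasurePreserving_eval (fun _ : Fin n => law p) a).preimage_null h0

/-! ### Bias of the kernel density estimate -/

theorem abs_secondDifference_le {d : ℕ} {p : Pt d → ℝ} (hp : ContDiff ℝ 3 p) {M : ℝ}
    (hM : ∀ x, ‖iteratedFDeriv ℝ 2 p x‖ ≤ M) (y v : Pt d) :
    |p (y - v) + p (y + v) - 2 * p y| ≤ 2 * M * ‖v‖ ^ 2 := by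
  have hM0 : 0 ≤ M := (norm_nonneg _).trans (hM y)
  have hdiff : Differentiable ℝ p := hp.differentiable (by norm_num)
  have hdiff2 : Differentiable ℝ (fderiv ℝ p) :=
    (hp.fderiv_right (m := 1) (by norm_num)).differentiable (by norm_num)
  have hlip : ∀ x z, ‖fderiv ℝ p z - fderiv ℝ p x‖ ≤ M * ‖z - x‖ := by
    intro x z
    refine convex_univ.norm_image_sub_le_of_norm_fderiv_le (𝕜 := ℝ)
      (fun w _ => hdiff2 w) (fun w _ => ?_) (mem_univ x) (mem_univ z)
    rw [← norm_iteratedFDeriv_one, norm_iteratedFDeriv_fderiv]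
    exact hM w
  -- The first order expansion at `y`, by the mean value inequality for `p - fderiv ℝ p y`.
  have hone : ∀ w : Pt d, ‖w‖ = ‖v‖ → |p (y + w) - p y - fderiv ℝ p y w| ≤ M * ‖v‖ ^ 2 := by
    intro w hw
    have h := (convex_closedBall y ‖v‖).norm_image_sub_le_of_norm_hasFDerivWithin_le (𝕜 := ℝ)
      (f := fun z => p z - fderiv ℝ p y z) (f' := fun z => fderiv ℝ p z - fderiv ℝ p y)
      (C := M * ‖v‖) (x := y) (y := y + w)
      (fun z _ => ((hdiff z).hasFDerivAt.sub (fderiv ℝ p y).hasFDerivAt).hasFDerivWithinAt)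
      (fun z hz => (hlip y z).trans (by
        rw [mem_closedBall, dist_eq_norm] at hz
        gcongr))
      (mem_closedBall_self (norm_nonneg v)) (by simp [hw])
    rw [add_sub_cancel_left, hw, map_add, Real.norm_eq_abs] at h
    have e : p (y + w) - (fderiv ℝ p y y + fderiv ℝ p y w) - (p y - fderiv ℝ p y y) =
        p (y + w) - p y - fderiv ℝ p y w := by ring
    rw [e] at h
    exact h.trans (le_of_eq (by ring))
  have h1 := abs_le.1 (hone v rfl)
  have h2 := hone (-v) (norm_neg v)
  rw [map_neg, ← sub_eq_add_neg] at h2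
  have h2 := abs_le.1 h2
  rw [abs_le]
  constructor <;> linarith [h1.1, h1.2, h2.1, h2.2]

theorem integral_law {d : ℕ} {p : Pt d → ℝ} (hp : IsBoundedDensity p) (g : Pt d → ℝ) :
    ∫ x, g x ∂(law p) = ∫ x, p x * g x := by
  rw [law, integral_withDensity_eq_integral_toReal_smul hp.measurable.ennreal_ofReal
    (ae_of_all _ fun _ => ENNReal.ofReal_lt_top)]
  simp only [ENNReal.toReal_ofReal (hp.nonneg _), smul_eq_mul]

/-- The expectation of a rescaled function as a convolution with the density. -/
theorem integral_law_scaled {d : ℕ} {p : Pt d → ℝ} (hp : IsBoundedDensity p) (K : Pt d → ℝ) {h : ℝ}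
    (hh : 0 < h) (y : Pt d) :
    ∫ x, K (h⁻¹ • (y - x)) ∂(law p) = h ^ d * ∫ v, K v * p (y - h • v) := by
  rw [integral_law hp]
  have h1 := integral_sub_left_eq_self (fun v => K (h⁻¹ • v) * p (y - v))
    (volume : Measure (Pt d)) y
  have h2 := Measure.integral_comp_inv_smul_of_nonneg (volume : Measure (Pt d))
    (fun v => K v * p (y - h • v)) hh.le
  simp only [sub_sub_cancel, smul_inv_smul₀ hh.ne', finrank_euclideanSpace_fin, smul_eq_mul]
    at h1 h2
  rw [← h2, ← h1]
  exact integral_congr_ae (ae_of_all _ fun x => mul_comm _ _)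

theorem integrable_mul_density {d : ℕ} {p : Pt d → ℝ} (hp : IsBoundedDensity p) {g : Pt d → ℝ}
    (hg : Integrable g) (y : Pt d) (c : ℝ) : Integrable fun v => g v * p (y + c • v) := by
  obtain ⟨M, hM⟩ := hp.bounded
  refine hg.mul_bdd (c := M)
    (hp.measurable.comp (by fun_prop)).aestronglyMeasurable (ae_of_all _ fun x => ?_)
  rw [Real.norm_eq_abs, abs_of_nonneg (hp.nonneg _)]
  exact hM _

/-- The bias is of second order in the bandwidth: averaging over `v` and `-v`, which an even kernel
does not distinguish, turns it into an integral of second differences. -/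
theorem abs_bias_le {d : ℕ} {p : Pt d → ℝ} (hp : IsBoundedDensity p) {K : Pt d → ℝ}
    (hK : IsKernel K) (hp3 : ContDiff ℝ 3 p) {M : ℝ}
    (hM : ∀ x, ‖iteratedFDeriv ℝ 2 p x‖ ≤ M) {h : ℝ} (hh : 0 < h) (y : Pt d) :
    |∫ x, K (h⁻¹ • (y - x)) ∂(law p) - h ^ d * p y| ≤
      h ^ d * (h ^ 2 * (M * ∫ v, ‖v‖ ^ 2 * |K v|)) := by
  have hi₁ : Integrable fun v => K v * p (y - h • v) := by
    have := integrable_mul_density hp hK.integrable y (-h)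
    simpa only [neg_smul, ← sub_eq_add_neg] using this
  have hi₂ : Integrable fun v => K v * p (y + h • v) := integrable_mul_density hp hK.integrable y h
  have hsymm : ∫ v, K v * p (y - h • v) = ∫ v, K v * p (y + h • v) := by
    rw [← integral_neg_eq_self (fun v => K v * p (y + h • v))]
    simp only [hK.even, smul_neg, sub_eq_add_neg]
  have hkey : (∫ v, K v * p (y - h • v)) - p y =
      (1 / 2) * ∫ v, K v * (p (y - h • v) + p (y + h • v) - 2 * p y) := by
    have e : ∀ v, K v * (p (y - h • v) + p (y + h • v) - 2 * p y) =
        K v * p (y - h • v) + K v * p (y + h • v) - 2 * p y * K v := fun v => by ring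
    simp_rw [e]
    have hadd : Integrable fun v => K v * p (y - h • v) + K v * p (y + h • v) := hi₁.add hi₂
    rw [integral_sub hadd (hK.integrable.const_mul _), integral_add hi₁ hi₂,
      integral_const_mul, hK.integral_eq_one, ← hsymm]
    ring
  have hint : Integrable fun v => ‖v‖ ^ 2 * |K v| := by
    have := hK.second_moment.norm
    simpa only [norm_mul, norm_pow, norm_norm, Real.norm_eq_abs, abs_norm] using this
  have hbound : |∫ v, K v * (p (y - h • v) + p (y + h • v) - 2 * p y)| ≤
      2 * (h ^ 2 * (M * ∫ v, ‖v‖ ^ 2 * |K v|)) := by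
    rw [← Real.norm_eq_abs]
    have h1 := norm_integral_le_of_norm_le (μ := (volume : Measure (Pt d)))
      (f := fun v => K v * (p (y - h • v) + p (y + h • v) - 2 * p y))
      (hint.const_mul (2 * (h ^ 2 * M))) (ae_of_all _ fun v => by
        rw [Real.norm_eq_abs, abs_mul]
        have h2 := abs_secondDifference_le hp3 hM y (h • v)
        rw [norm_smul, Real.norm_eq_abs, mul_pow, sq_abs] at h2
        calc |K v| * |p (y - h • v) + p (y + h • v) - 2 * p y|
            ≤ |K v| * (2 * M * (h ^ 2 * ‖v‖ ^ 2)) := by gcongr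
          _ = _ := by ring)
    rw [integral_const_mul] at h1
    exact h1.trans (le_of_eq (by ring))
  rw [integral_law_scaled hp K hh y, ← mul_sub, abs_mul, abs_of_pos (pow_pos hh d), hkey, abs_mul]
  refine mul_le_mul_of_nonneg_left ?_ (pow_pos hh d).le
  rw [abs_of_pos (by norm_num : (0 : ℝ) < 1 / 2)]
  linarith

/-! ### Concentration of the kernel density estimate -/

/-- The exponential moment of a bounded centered variable is controlled by its second moment. -/
theorem integral_exp_mul_sub_integral_le {α : Type*} [MeasurableSpace α] (μ : Measure α)
    [IsProbabilityMeasure μ] {Y : α → ℝ} (hY : Measurable Y) {B l v : ℝ} (hB : ∀ x, |Y x| ≤ B)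
    (hl : |l| * B ≤ 1) (hv : ∫ x, Y x ^ 2 ∂μ ≤ v) :
    Integrable (fun x => Real.exp (l * (Y x - ∫ z, Y z ∂μ))) μ ∧
      ∫ x, Real.exp (l * (Y x - ∫ z, Y z ∂μ)) ∂μ ≤ Real.exp (l ^ 2 * v) := by
  set e := ∫ z, Y z ∂μ with he
  have hYi : Integrable Y μ := Integrable.of_bound hY.aestronglyMeasurable B (ae_of_all _ hB)
  have hY2i : Integrable (fun x => Y x ^ 2) μ :=
    Integrable.of_bound (hY.pow_const 2).aestronglyMeasurable (B ^ 2) (ae_of_all _ fun x => by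
      rw [Real.norm_eq_abs, abs_pow]
      exact pow_le_pow_left₀ (abs_nonneg _) (hB x) 2)
  have hle : ∀ x, Real.exp (l * Y x) ≤ 1 + l * Y x + l ^ 2 * Y x ^ 2 := by
    intro x
    have h1 : |l * Y x| ≤ 1 := by
      rw [abs_mul]
      exact (mul_le_mul_of_nonneg_left (hB x) (abs_nonneg l)).trans hl
    have h2 := (abs_le.1 (Real.abs_exp_sub_one_sub_id_le h1)).2
    rw [mul_pow] at h2
    linarith
  have hexpi : Integrable (fun x => Real.exp (l * Y x)) μ :=
    Integrable.of_bound (Real.measurable_exp.comp (hY.const_mul l)).aestronglyMeasurable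
      (Real.exp 1) (ae_of_all _ fun x => by
        rw [Real.norm_eq_abs, Real.abs_exp, Real.exp_le_exp]
        have : |l * Y x| ≤ 1 := by
          rw [abs_mul]
          exact (mul_le_mul_of_nonneg_left (hB x) (abs_nonneg l)).trans hl
        exact (le_abs_self _).trans this)
  have hsplit : ∀ x, Real.exp (l * (Y x - e)) = Real.exp (-(l * e)) * Real.exp (l * Y x) := by
    intro x
    rw [← Real.exp_add]
    congr 1
    ring
  simp_rw [hsplit]
  refine ⟨hexpi.const_mul _, ?_⟩
  rw [integral_const_mul]
  have hlin : Integrable (fun x => 1 + l * Y x) μ := (integrable_const _).add (hYi.const_mul l)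
  have h3 : ∫ x, Real.exp (l * Y x) ∂μ ≤ 1 + l * e + l ^ 2 * v := by
    calc ∫ x, Real.exp (l * Y x) ∂μ ≤ ∫ x, (1 + l * Y x + l ^ 2 * Y x ^ 2) ∂μ :=
          integral_mono hexpi (hlin.add (hY2i.const_mul _)) hle
      _ = 1 + l * e + l ^ 2 * ∫ x, Y x ^ 2 ∂μ := by
          rw [integral_add hlin (hY2i.const_mul _),
            integral_add (integrable_const _) (hYi.const_mul l), integral_const_mul,
            integral_const_mul, ← he]
          simp
      _ ≤ _ := by gcongr
  calc Real.exp (-(l * e)) * ∫ x, Real.exp (l * Y x) ∂μ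
      ≤ Real.exp (-(l * e)) * Real.exp (l * e + l ^ 2 * v) := by
        gcongr
        linarith [Real.add_one_le_exp (l * e + l ^ 2 * v)]
    _ = _ := by rw [← Real.exp_add]; congr 1; ring

/-- The second moment of the summands is of order `h ^ d`. This is what makes the rate in the
concentration bound proportional to `h ^ d` and not to `h ^ (2 * d)`. -/
theorem integral_law_sq_scaled_le {d : ℕ} {p : Pt d → ℝ} (hp : IsBoundedDensity p) {K : Pt d → ℝ}
    (hK : IsKernel K) {P B : ℝ} (hP : ∀ x, p x ≤ P) (hB : ∀ x, |K x| ≤ B) {h : ℝ} (hh : 0 < h)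
    (y : Pt d) :
    ∫ x, K (h⁻¹ • (y - x)) ^ 2 ∂(law p) ≤ h ^ d * (P * B * ∫ v, |K v|) := by
  rw [integral_law_scaled hp (fun v => K v ^ 2) hh y]
  gcongr
  rw [← integral_const_mul]
  refine integral_mono_of_nonneg (ae_of_all _ fun v => mul_nonneg (sq_nonneg _) (hp.nonneg _))
    (hK.integrable.abs.const_mul _) (ae_of_all _ fun v => ?_)
  have h1 : K v ^ 2 ≤ B * |K v| := by
    rw [← sq_abs, sq]
    exact mul_le_mul_of_nonneg_right (hB v) (abs_nonneg _)
  have h0 : 0 ≤ B * |K v| := (sq_nonneg _).trans h1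
  calc K v ^ 2 * p (y - h • v) ≤ (B * |K v|) * P :=
        mul_le_mul h1 (hP _) (hp.nonneg _) h0
    _ = _ := by ring

theorem sampleLaw_leaveOneOut_deviation_le {d : ℕ} {p : Pt d → ℝ} (hp : IsBoundedDensity p)
    {K : Pt d → ℝ} (hK : IsKernel K) {P B : ℝ} (hP : ∀ x, p x ≤ P) (hB : ∀ x, |K x| ≤ B) {h : ℝ}
    (hh : 0 < h) {n : ℕ} (a : Fin (n + 1)) {l : ℝ} (hl : |l| * B ≤ 1) (τ : ℝ) :
    (sampleLaw p (n + 1)).real {x | τ ≤ l * (∑ j, K (h⁻¹ • (x a - x (a.succAbove j)))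
        - n * ∫ z, K (h⁻¹ • (x a - z)) ∂(law p))} ≤
      Real.exp (n * (l ^ 2 * (h ^ d * (P * B * ∫ v, |K v|))) - τ) := by
  have := isProbabilityMeasure_law hp
  have hm : Measurable (Function.uncurry fun y x : Pt d => K (h⁻¹ • (y - x))) :=
    hK.measurable.comp ((measurable_fst.sub measurable_snd).const_smul h⁻¹)
  have hm2 : Measurable (Function.uncurry fun y x : Pt d =>
      l * (K (h⁻¹ • (y - x)) - ∫ z, K (h⁻¹ • (y - z)) ∂(law p))) :=
    (hm.sub ((hm.stronglyMeasurable.integral_prod_right').measurable.comp measurable_fst)).const_mul l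
  have hmy : ∀ y, Measurable fun x : Pt d => K (h⁻¹ • (y - x)) :=
    fun y => hm.comp (measurable_const.prodMk measurable_id)
  have hmgf := fun y => integral_exp_mul_sub_integral_le (law p) (hmy y) (fun x => hB _) hl
    (integral_law_sq_scaled_le hp hK hP hB hh y)
  have := pi_leaveOneOut_ge_le_exp (law p) a MeasurableSet.univ hm2
    (fun y _ => (hmgf y).1) (fun y _ => (hmgf y).2) τ
  rw [probReal_univ, one_mul] at this
  refine le_trans (le_of_eq ?_) this
  rw [sampleLaw]
  congr 1
  ext x
  simp only [mem_ofPred_eq, mem_univ, true_and, ← Finset.mul_sum, Finset.sum_sub_distrib,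
    Finset.sum_const, Finset.card_univ, Fintype.card_fin, nsmul_eq_mul]

theorem eventually_mul_exp_neg_le {c w ε : ℝ} (hw : 0 < w) (hε : 0 < ε) :
    ∀ᶠ n : ℕ in atTop, c * (n * Real.exp (-(n * w))) ≤ ε := by
  have h1 := Real.tendsto_pow_mul_exp_neg_atTop_nhds_zero 1
  have h2 : Tendsto (fun n : ℕ => (n : ℝ) * w) atTop atTop :=
    tendsto_natCast_atTop_atTop.atTop_mul_const hw
  have h3 := (h1.comp h2).const_mul (c / w)
  rw [mul_zero] at h3
  filter_upwards [h3.eventually (gt_mem_nhds hε)] with n hn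
  refine le_of_eq_of_le ?_ hn.le
  simp only [Function.comp_apply, pow_one]
  field_simp

/-- At a fixed bandwidth, the density estimates at the sample points deviate from the density by
less than `ε`, up to an exponentially small probability. The restriction `ε ≤ P` keeps the
exponential moments in the quadratic range. The summand of the point itself, the difference
between `n` and `n - 1`, and the number of points in the union bound are absorbed by large `n`. -/
theorem exists_kde_concentration {d : ℕ} {p : Pt d → ℝ} (hp : IsBoundedDensity p)
    {K : Pt d → ℝ} (hK : IsKernel K) (hp3 : IsC3Bounded p) {P : ℝ} (hP0 : 0 < P)
    (hP : ∀ x, p x ≤ P) :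
    ∃ C₁ C₂ : ℝ, 0 < C₁ ∧ 0 < C₂ ∧ ∀ ε h : ℝ, 0 < ε → ε ≤ P → 0 < h → h ^ 2 ≤ C₁ * ε →
      ∀ᶠ n : ℕ in atTop,
        (sampleLaw p n).real {x | ¬ ∀ a, |kde K h x (x a) - p (x a)| < ε} ≤
          3 * Real.exp (-(n * (C₂ * h ^ d * ε ^ 2))) / 2 := by
  obtain ⟨hp3, M, hM⟩ := hp3
  have hM2 : ∀ x, ‖iteratedFDeriv ℝ 2 p x‖ ≤ M := hM 2 (by norm_num)
  have hM0 : 0 ≤ M := (norm_nonneg _).trans (hM2 0)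
  obtain ⟨B, hB0, hB⟩ : ∃ B : ℝ, 0 < B ∧ ∀ x, |K x| ≤ B := by
    obtain ⟨B, hB⟩ := hK.bounded
    exact ⟨max B 1, by positivity, fun x => (hB x).trans (le_max_left _ _)⟩
  set I := ∫ v, |K v| with hI
  have hI1 : 1 ≤ I := by
    have := abs_integral_le_integral_abs (f := K) (μ := (volume : Measure (Pt d)))
    rwa [hK.integral_eq_one, abs_one] at this
  set S := ∫ v, ‖v‖ ^ 2 * |K v| with hS
  have hS0 : 0 ≤ S := integral_nonneg fun v => by positivity
  -- The multiplier of the deviation `ε` in the exponential moment.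
  set θ := 1 / (8 * P * B * I) with hθ
  have hθ0 : 0 < θ := by positivity
  refine ⟨1 / (4 * (M * S + 1)), θ / 16, by positivity, by positivity, ?_⟩
  intro ε h hε hεP hh hhε
  have hhd : 0 < h ^ d := pow_pos hh d
  have hbias : ∀ y, |∫ x, K (h⁻¹ • (y - x)) ∂(law p) - h ^ d * p y| ≤ h ^ d * (ε / 4) := by
    intro y
    refine (abs_bias_le hp hK hp3 hM2 hh y).trans ?_
    rw [← hS]
    gcongr
    calc h ^ 2 * (M * S) ≤ 1 / (4 * (M * S + 1)) * ε * (M * S + 1) := by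
          gcongr
          linarith
      _ = ε / 4 := by field_simp
  set w := h ^ d * ε ^ 2 * θ / 16 with hw
  have hw0 : 0 < w := by positivity
  have hEB : ∀ y, |∫ x, K (h⁻¹ • (y - x)) ∂(law p)| ≤ B := by
    intro y
    have := isProbabilityMeasure_law hp
    rw [← Real.norm_eq_abs]
    refine (norm_integral_le_of_norm_le_const (ae_of_all _ fun x => ?_)).trans
      (le_of_eq (by rw [probReal_univ, mul_one]))
    exact hB _
  have hself : ∀ᶠ n : ℕ in atTop, 2 * B < n * (h ^ d * (ε / 2)) :=
    (tendsto_natCast_atTop_atTop.atTop_mul_const (by positivity)).eventually_gt_atTop _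
  filter_upwards [hself, eventually_ge_atTop 1,
    eventually_mul_exp_neg_le (c := 2 * Real.exp (2 * w)) (ε := 3 / 2) hw0 (by norm_num)]
    with n hn hn1 hnexp
  obtain ⟨N, rfl⟩ : ∃ N, n = N + 1 := ⟨n - 1, by omega⟩
  have := isProbabilityMeasure_sampleLaw hp (N + 1)
  set l := θ * ε with hl
  have hl0 : 0 < l := by positivity
  have hlB : |l| * B ≤ 1 := by
    rw [abs_of_pos hl0, hl, hθ]
    rw [show 1 / (8 * P * B * I) * ε * B = ε / (8 * P * I) by field_simp, div_le_one (by positivity)]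
    nlinarith
  set dev : Fin (N + 1) → (Fin (N + 1) → Pt d) → ℝ := fun a x =>
    ∑ j, K (h⁻¹ • (x a - x (a.succAbove j))) - N * ∫ z, K (h⁻¹ • (x a - z)) ∂(law p) with hdev
  set τ := l * (N * (h ^ d * (ε / 4))) with hτ
  have hsub : {x : Fin (N + 1) → Pt d | ¬ ∀ a, |kde K h x (x a) - p (x a)| < ε} ⊆
      ⋃ a, ({x | τ ≤ l * dev a x} ∪ {x | τ ≤ -l * dev a x}) := by
    intro x hx
    obtain ⟨a, ha⟩ := not_forall.1 hx
    refine mem_iUnion.2 ⟨a, ?_⟩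
    by_contra hcon
    rw [mem_union, not_or] at hcon
    obtain ⟨h1, h2⟩ := hcon
    simp only [mem_ofPred_eq, not_le, hτ] at h1 h2
    have h3 : dev a x < N * (h ^ d * (ε / 4)) := lt_of_mul_lt_mul_left h1 hl0.le
    have h4 : -dev a x < N * (h ^ d * (ε / 4)) :=
      lt_of_mul_lt_mul_left (by linarith : l * -dev a x < _) hl0.le
    refine ha ?_
    set y := x a with hy
    set e := ∫ z, K (h⁻¹ • (y - z)) ∂(law p) with he
    -- Split off the summand of the point itself, and the bias from the deviation.
    have hsum : ∑ j, K (h⁻¹ • (y - x j)) = K 0 + (dev a x + N * e) := by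
      rw [Fin.sum_univ_succAbove _ a, hdev]
      simp only [← hy, sub_self, smul_zero]
      ring
    have hN : ((N + 1 : ℕ) : ℝ) = N + 1 := by push_cast; ring
    have hkde : kde K h x y - p y = (K 0 - e + dev a x + (N + 1) * (e - h ^ d * p y)) /
        ((N + 1) * h ^ d) := by
      rw [kde, hsum, hN]
      have : (N : ℝ) + 1 ≠ 0 := by positivity
      field_simp
      ring
    rw [hkde, abs_div, abs_of_pos (by positivity : (0 : ℝ) < (N + 1) * h ^ d),
      div_lt_iff₀ (by positivity)]
    have h5 := abs_le.1 (hbias y)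
    have h6 := abs_le.1 (hEB y)
    have h7 := abs_le.1 (hB 0)
    rw [hN] at hn
    have h8 : (0 : ℝ) < N + 1 := by positivity
    have h9 : ((N : ℝ) + 1) * (e - h ^ d * p y) ≤ (N + 1) * (h ^ d * (ε / 4)) :=
      mul_le_mul_of_nonneg_left h5.2 h8.le
    have h10 : ((N : ℝ) + 1) * -(h ^ d * (ε / 4)) ≤ (N + 1) * (e - h ^ d * p y) :=
      mul_le_mul_of_nonneg_left h5.1 h8.le
    have h11 : 0 < h ^ d * (ε / 4) := by positivity
    rw [abs_lt]
    constructor <;> linarith [h6.1, h6.2, h7.1, h7.2]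
  have hexp : (N : ℝ) * (l ^ 2 * (h ^ d * (P * B * I))) - τ = -(N * (2 * w)) := by
    rw [hτ, hl, hw, hθ]
    field_simp
    ring
  have hterm : ∀ a : Fin (N + 1), (sampleLaw p (N + 1)).real
      ({x | τ ≤ l * dev a x} ∪ {x | τ ≤ -l * dev a x}) ≤ 2 * Real.exp (-(N * (2 * w))) := by
    intro a
    have h1 := sampleLaw_leaveOneOut_deviation_le hp hK hP hB hh a hlB τ
    have h2 := sampleLaw_leaveOneOut_deviation_le hp hK hP hB hh a (l := -l) (by rwa [abs_neg]) τ
    rw [neg_sq] at h2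
    rw [← hI, hexp] at h1 h2
    refine (measureReal_union_le _ _).trans ?_
    linarith
  refine (measureReal_mono hsub).trans ((measureReal_iUnion_fintype_le _).trans ?_)
  refine (Finset.sum_le_sum fun a _ => hterm a).trans ?_
  rw [Finset.sum_const, Finset.card_univ, Fintype.card_fin, nsmul_eq_mul]
  have hC2 : θ / 16 * h ^ d * ε ^ 2 = w := by rw [hw]; ring
  rw [hC2]
  have e1 : Real.exp (-(N * (2 * w))) = Real.exp (2 * w) *
      (Real.exp (-(((N + 1 : ℕ) : ℝ) * w)) * Real.exp (-(((N + 1 : ℕ) : ℝ) * w))) := by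
    rw [← Real.exp_add, ← Real.exp_add]
    congr 1
    push_cast
    ring
  rw [e1]
  calc ((N + 1 : ℕ) : ℝ) * (2 * (Real.exp (2 * w) *
      (Real.exp (-(((N + 1 : ℕ) : ℝ) * w)) * Real.exp (-(((N + 1 : ℕ) : ℝ) * w)))))
      = (2 * Real.exp (2 * w) * (((N + 1 : ℕ) : ℝ) * Real.exp (-(((N + 1 : ℕ) : ℝ) * w)))) *
        Real.exp (-(((N + 1 : ℕ) : ℝ) * w)) := by ring
    _ ≤ 3 / 2 * Real.exp (-(((N + 1 : ℕ) : ℝ) * w)) := by gcongr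
    _ = _ := by ring

/-! ### Rough identification in the noisy case -/

theorem levelSet_eq_of_continuous {d : ℕ} {p : Pt d → ℝ} (hp : Continuous p) (t : ℝ) :
    levelSet p t = {x | t ≤ p x} :=
  (isClosed_le continuous_const hp).closure_eq

/-- The mass of balls of a fixed radius has no positive lower bound on the whole space. -/
theorem exists_law_real_ball_lt {d : ℕ} (hd : 0 < d) {p : Pt d → ℝ} (hp : IsBoundedDensity p)
    {u ρ : ℝ} (hu : 0 < u) (hρ : 0 < ρ) : ∃ x, (law p).real (ball x u) < ρ := by
  by_contra! hcon
  have := isProbabilityMeasure_law hp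
  let c : ℕ → Pt d := fun j => EuclideanSpace.single ⟨0, hd⟩ (2 * u * j)
  obtain ⟨N, hN⟩ := exists_nat_gt (1 / ρ)
  rw [div_lt_iff₀ hρ] at hN
  have hdisj : Set.PairwiseDisjoint (↑(Finset.range N)) fun j => ball (c j) u := by
    intro i _ j _ hij
    refine ball_disjoint_ball ?_
    have h1 : dist (c i) (c j) = 2 * u * |(i : ℝ) - j| := by
      rw [PiLp.dist_single_same, Real.dist_eq, ← mul_sub, abs_mul,
        abs_of_pos (by positivity)]
    have h2 : (1 : ℝ) ≤ |(i : ℝ) - j| := by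
      have : (1 : ℤ) ≤ |(i : ℤ) - j| := Int.one_le_abs (sub_ne_zero.2 (by exact_mod_cast hij))
      exact_mod_cast this
    rw [h1]
    nlinarith
  have h3 := measureReal_biUnion_finset (μ := law p) hdisj (fun _ _ => measurableSet_ball)
  have h4 : (N : ℝ) * ρ ≤ ∑ j ∈ Finset.range N, (law p).real (ball (c j) u) := by
    calc (N : ℝ) * ρ = ∑ _j ∈ Finset.range N, ρ := by simp
      _ ≤ _ := Finset.sum_le_sum fun j _ => hcon (c j)
  have h5 : (law p).real (⋃ j ∈ Finset.range N, ball (c j) u) ≤ 1 := measureReal_le_one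
  linarith

/-- The mass condition for the enlarged clusters forces the enlargement to keep the level
positive: at a nonpositive level the enlarged clusters would be the whole space. -/
theorem lt_of_isSeparated_enlarge {d m : ℕ} (hd : 0 < d) {p : Pt d → ℝ} (hp : IsBoundedDensity p)
    {t : ℝ} {C : Fin m → Set (Pt d)} {u ρ : Fin m → ℝ} (hC : IsClusters p t C) {s : ℝ} (hs : 0 ≤ s)
    (hsep : IsSeparated p (fun i => enlarge p t s (C i)) u ρ) (i : Fin m) : s < t := by
  by_contra! hle
  obtain ⟨x, hx⟩ := (hC.isConnected i).nonempty
  have huniv : levelSet p (t - s) = univ :=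
    eq_univ_of_forall fun y => subset_closure ((by linarith : t - s ≤ 0).trans (hp.nonneg y))
  have hE : enlarge p t s (C i) = univ := by
    rw [enlarge_eq_connectedComponentIn hs (hC.subset_levelSet i)
      (hC.isConnected i).isPreconnected hx, huniv, connectedComponentIn_univ,
      PreconnectedSpace.connectedComponent_eq_univ]
  obtain ⟨y, hy⟩ := exists_law_real_ball_lt hd hp (hsep.u_pos i) (hsep.rho_pos i)
  have hyE : y ∈ enlarge p t s (C i) := by rw [hE]; exact mem_univ y
  exact absurd hy (not_lt.2 (hsep.le_mass i y hyE))

/-- The size of a component does not depend on the vertex representing it. -/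
theorem ncard_induce_reachable_of_reachable {n : ℕ} {G : SimpleGraph (Fin n)} {S : Set (Fin n)}
    {a b : S} (h : (G.induce S).Reachable a b) :
    {c : S | (G.induce S).Reachable b c}.ncard = {c : S | (G.induce S).Reachable a c}.ncard := by
  congr 1
  ext c
  exact ⟨fun hc => h.trans hc, fun hc => h.symm.trans hc⟩

/-- Removing small components does not change the other ones. -/
theorem reachable_largeVertices {n : ℕ} {G : SimpleGraph (Fin n)} {S : Set (Fin n)} {s : ℝ}
    {a b : S} (ha : a.1 ∈ largeVertices G S s) (h : (G.induce S).Reachable a b) :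
    ∃ hb : b.1 ∈ largeVertices G S s,
      (G.induce (largeVertices G S s)).Reachable ⟨a.1, ha⟩ ⟨b.1, hb⟩ := by
  obtain ⟨w⟩ := h
  induction w with
  | nil => exact ⟨ha, SimpleGraph.Reachable.refl _⟩
  | @cons a e c hae w ih =>
    have he : e.1 ∈ largeVertices G S s := by
      obtain ⟨ha', hs⟩ := ha
      refine ⟨e.2, ?_⟩
      rw [ncard_induce_reachable_of_reachable (a := a) hae.reachable]
      exact hs
    obtain ⟨hc, hr⟩ := ih he
    refine ⟨hc, SimpleGraph.Reachable.trans (SimpleGraph.Adj.reachable ?_) hr⟩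
    exact hae

/-- The deterministic part of rough identification. Up to an error below `ε` in the density
estimates, the first pruning step keeps the points of the clusters and leaves only points
of the enlarged clusters, between which there are no edges. A component without cluster points
consists of background points, of which there are too few to survive the second step. -/
theorem isRoughlyIdentified_of_linked_isolated {d m n k : ℕ} {p : Pt d → ℝ}
    (hp : Continuous p) {t : ℝ} {C : Fin m → Set (Pt d)} {u ρ : Fin m → ℝ} {ε₀ ε δ h : ℝ}
    (hC : IsClusters p t C) (hε₀ : 0 < ε₀)
    (hsep : IsSeparated p (fun i => enlarge p t (2 * ε₀) (C i)) u ρ) (hεε₀ : ε ≤ ε₀)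
    (hcov : levelSet p (t - 2 * ε) ⊆ ⋃ i, enlarge p t (2 * ε) (C i)) {K : Pt d → ℝ}
    {x : Fin n → Pt d}
    (hlink : ∀ i, IsLinked (C i) k x ∧ IsIsolated (enlarge p t (2 * ε₀) (C i)) (u i) k x)
    (hkde : ∀ a, |kde K h x (x a) - p (x a)| < ε)
    (hmany : ∀ i, δ * n ≤ ({a | x a ∈ C i}.ncard : ℝ))
    (hfew : ({a | x a ∈ ⋃ i, enlarge p t (2 * ε) (C i) \ C i}.ncard : ℝ) < δ * n) (i : Fin m) :
    IsRoughlyIdentified C x (mutualKNN k x) (tildeVertices K h k (t - ε) δ x) i := by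
  set S := denseVertices (fun a => kde K h x (x a)) (t - ε) with hS
  set V := tildeVertices K h k (t - ε) δ x with hV
  have hCS : ∀ j a, x a ∈ C j → a ∈ S := by
    intro j a ha
    have h1 := hC.subset_levelSet j ha
    rw [levelSet_eq_of_continuous hp] at h1
    have h2 : t ≤ p (x a) := h1
    have h3 : t - ε ≤ kde K h x (x a) := by linarith [(abs_lt.1 (hkde a)).1]
    exact h3
  have hSE : ∀ a ∈ S, ∃ j, x a ∈ enlarge p t (2 * ε) (C j) := by
    intro a ha
    have h1 : t - ε ≤ kde K h x (x a) := ha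
    have h2 : t - 2 * ε ≤ p (x a) := by linarith [(abs_lt.1 (hkde a)).2]
    exact mem_iUnion.1 (hcov (subset_closure h2))
  have hVS : V ⊆ S := fun a ha => ha.1
  have hCV : ∀ j a, x a ∈ C j → a ∈ V := by
    intro j a ha
    refine ⟨hCS j a ha, (hmany j).trans (Nat.cast_le.2 ?_)⟩
    rw [← Set.ncard_image_of_injective _ Subtype.val_injective]
    refine Set.ncard_le_ncard (fun b hb => ?_) (Set.toFinite _)
    exact ⟨⟨b, hCS j b hb⟩, (hlink j).1 S (hCS j) ⟨a, hCS j a ha⟩ ⟨b, hCS j b hb⟩ ha hb, rfl⟩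
  have hEE : ∀ j, enlarge p t (2 * ε) (C j) ⊆ enlarge p t (2 * ε₀) (C j) :=
    fun j => enlarge_subset_enlarge (by linarith)
  have hCE : ∀ j, C j ⊆ enlarge p t (2 * ε₀) (C j) :=
    fun j => subset_enlarge (by linarith) (hC.subset_levelSet j)
  refine ⟨hCV i, fun a b ha hb => (hlink i).1 V (hCV i) a b ha hb, fun c => ?_⟩
  -- Every component stays within one of the enlarged clusters.
  have hstay : ∀ j, ∀ a b : V, x a ∈ enlarge p t (2 * ε₀) (C j) →
      ((mutualKNN k x).induce V).Reachable a b → x b ∈ enlarge p t (2 * ε₀) (C j) := by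
    rintro j a b ha ⟨w⟩
    induction w with
    | nil => exact ha
    | @cons a e c hae w ih =>
      obtain ⟨l, hl⟩ := hSE e.1 (hVS e.2)
      by_cases hjl : j = l
      · exact ih (hEE j (hjl ▸ hl))
      · exact absurd ((hlink j).2 a e ha hae)
          (not_lt.2 (hsep.le_dist j l hjl _ ha _ (hEE l hl)))
  obtain ⟨j, a, ha, haj⟩ : ∃ j, ∃ a ∈ c.supp, x a ∈ C j := by
    by_contra! hcon
    induction c using SimpleGraph.ConnectedComponent.ind with
    | h v =>
    obtain ⟨hvS, hsize⟩ := v.2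
    refine absurd (hsize.trans (Nat.cast_le.2 ?_)) (not_le.2 hfew)
    rw [← Set.ncard_image_of_injective _ Subtype.val_injective]
    refine Set.ncard_le_ncard ?_ (Set.toFinite _)
    rintro _ ⟨b, hb, rfl⟩
    obtain ⟨hbV, hvb⟩ := reachable_largeVertices (a := ⟨v.1, hvS⟩) v.2 hb
    obtain ⟨l, hl⟩ := hSE b.1 b.2
    refine mem_iUnion.2 ⟨l, hl, hcon l ⟨b.1, hbV⟩ ?_⟩
    exact SimpleGraph.ConnectedComponent.eq.2 hvb.symm
  refine ⟨j, ⟨a, ha, haj⟩, ?_⟩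
  rintro l ⟨b, hb, hbl⟩
  by_contra hlj
  have hab : ((mutualKNN k x).induce V).Reachable a b :=
    SimpleGraph.ConnectedComponent.eq.1 (ha.trans hb.symm)
  have h1 := hsep.le_dist l j hlj _ (hCE l hbl) _ (hstay j a b (hCE j haj) hab)
  rw [dist_self] at h1
  exact absurd h1 (not_le.2 (hsep.u_pos l))

theorem sampleLaw_ncard_lt_le {d : ℕ} {p : Pt d → ℝ} (hp : IsBoundedDensity p) {n : ℕ}
    {B : Set (Pt d)} (hB : MeasurableSet B) {δ : ℝ} (hδ : 2 * δ ≤ (law p).real B) :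
    (sampleLaw p n).real {x | ({a | x a ∈ B}.ncard : ℝ) < δ * n} ≤
      Real.exp (-(n * (δ * (13 / 50)))) := by
  have := isProbabilityMeasure_law hp
  have := isProbabilityMeasure_sampleLaw hp n
  -- Chernoff's bound with parameter `-1`, where `1 - exp (-1) ≥ 63 / 100`.
  have h1 := pi_mul_count_ge_le_exp (law p) (n := n) hB (l := -1) (c := -(63 / 100) * (2 * δ))
    (by
      have h1 := exp_neg_one_sub_one_le
      have h3 : 0 ≤ (law p).real B := measureReal_nonneg
      nlinarith) (-(δ * n))
  refine (measureReal_mono ?_).trans (h1.trans (le_of_eq ?_))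
  · intro x hx
    have : ({a | x a ∈ B}.ncard : ℝ) < δ * n := hx
    show -(δ * n) ≤ -1 * ({a | x a ∈ B}.ncard : ℝ)
    linarith
  · congr 1; ring

theorem sampleLaw_le_ncard_le {d : ℕ} {p : Pt d → ℝ} (hp : IsBoundedDensity p) {n : ℕ}
    {B : Set (Pt d)} (hB : MeasurableSet B) {δ : ℝ} (hδ0 : 0 ≤ δ) (hδ : (law p).real B ≤ δ / 2) :
    (sampleLaw p n).real {x | δ * n ≤ ({a | x a ∈ B}.ncard : ℝ)} ≤
      Real.exp (-(n * (δ * (19 / 100)))) := by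
  have := isProbabilityMeasure_law hp
  have := isProbabilityMeasure_sampleLaw hp n
  -- Chernoff's bound with parameter `log 2`, which leaves the rate `log 2 - 1 / 2 > 19 / 100`.
  have h1 := pi_mul_count_ge_le_exp (law p) (n := n) hB (l := Real.log 2) (c := δ / 2)
    (by rw [Real.exp_log two_pos]; linarith) (Real.log 2 * (δ * n))
  refine (measureReal_mono ?_).trans (h1.trans ?_)
  · intro x hx
    have : δ * n ≤ ({a | x a ∈ B}.ncard : ℝ) := hx
    exact mul_le_mul_of_nonneg_left this (Real.log_pos one_lt_two).le
  · rw [Real.exp_le_exp]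
    have h2 : 0 ≤ (n : ℝ) * δ := by positivity
    nlinarith [Real.log_two_gt_d9]

/-- The clusters contain many sample points and the background contains few of them. -/
theorem eventually_sampleLaw_counts_le {d m : ℕ} {p : Pt d → ℝ} (hp : IsBoundedDensity p)
    {C : Fin m → Set (Pt d)} (hC : ∀ i, MeasurableSet (C i)) {B : Set (Pt d)}
    (hB : MeasurableSet B) {δ : ℝ} (hδ0 : 0 < δ) (hδ : ∀ i, 2 * δ < (law p).real (C i))
    (hBδ : (law p).real B ≤ δ / 2) :
    ∀ᶠ n : ℕ in atTop,
      (sampleLaw p n).real {x | ¬ ((∀ i, δ * n ≤ ({a | x a ∈ C i}.ncard : ℝ)) ∧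
        ({a | x a ∈ B}.ncard : ℝ) < δ * n)} ≤ Real.exp (-(n * (δ / 8))) := by
  filter_upwards [eventually_mul_exp_neg_le (c := (m : ℝ) + 1) (w := δ * (13 / 200)) (ε := 1)
    (by positivity) one_pos, eventually_ge_atTop 1] with n hn hn1
  have := isProbabilityMeasure_sampleLaw hp n
  have hn1' : (1 : ℝ) ≤ n := by exact_mod_cast hn1
  have hsub : {x : Fin n → Pt d | ¬ ((∀ i, δ * n ≤ ({a | x a ∈ C i}.ncard : ℝ)) ∧
        ({a | x a ∈ B}.ncard : ℝ) < δ * n)} ⊆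
      (⋃ i, {x | ({a | x a ∈ C i}.ncard : ℝ) < δ * n}) ∪
        {x | δ * n ≤ ({a | x a ∈ B}.ncard : ℝ)} := by
    intro x hx
    rcases not_and_or.1 hx with h | h
    · obtain ⟨i, hi⟩ := not_forall.1 h
      exact Or.inl (mem_iUnion.2 ⟨i, not_le.1 hi⟩)
    · exact Or.inr (not_lt.1 h)
  have h1 : (sampleLaw p n).real (⋃ i, {x | ({a | x a ∈ C i}.ncard : ℝ) < δ * n}) ≤
      m * Real.exp (-(n * (δ * (19 / 100)))) := by
    refine (measureReal_iUnion_fintype_le _).trans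
      ((Finset.sum_le_sum fun i _ => sampleLaw_ncard_lt_le hp (hC i) (hδ i).le).trans ?_)
    rw [Finset.sum_const, Finset.card_univ, Fintype.card_fin, nsmul_eq_mul]
    refine mul_le_mul_of_nonneg_left (Real.exp_le_exp.2 ?_) (Nat.cast_nonneg m)
    have : 0 ≤ (n : ℝ) * δ := by positivity
    linarith
  refine (measureReal_mono hsub).trans ((measureReal_union_le _ _).trans
    ((add_le_add h1 (sampleLaw_le_ncard_le hp hB hδ0.le hBδ)).trans ?_))
  have e : Real.exp (-(n * (δ * (19 / 100)))) =
      Real.exp (-(n * (δ * (13 / 200)))) * Real.exp (-(n * (δ / 8))) := by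
    rw [← Real.exp_add]; congr 1; ring
  rw [e]
  have h2 : ((m : ℝ) + 1) * Real.exp (-(n * (δ * (13 / 200)))) ≤ 1 := by
    refine le_trans ?_ hn
    gcongr
    exact le_mul_of_one_le_left (Real.exp_pos _).le hn1'
  calc _ = (((m : ℝ) + 1) * Real.exp (-(n * (δ * (13 / 200))))) * Real.exp (-(n * (δ / 8))) := by
        ring
    _ ≤ 1 * Real.exp (-(n * (δ / 8))) := by gcongr
    _ = _ := one_mul _

theorem exponentNoisy_optimalK {d n : ℕ} {ρ P t : ℝ} (hP : 0 < P) (ht : 0 < t) (hn : 2 ≤ n)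
    (δ c h ε : ℝ) :
    exponentNoisy d ρ P t δ c h ε n (optimalK d ρ P t n) =
      ((n : ℝ) - 1) * rateNoisy d ρ P t δ c h ε n := by
  have hn' : (0 : ℝ) < n - 1 := by
    have : (2 : ℝ) ≤ n := by exact_mod_cast hn
    linarith
  rw [exponentNoisy, exponentNoiseFree_optimalK hP ht hn, rateNoisy, mul_min_of_nonneg _ _ hn'.le,
    mul_min_of_nonneg _ _ hn'.le]
  congr 2 <;> field_simp

theorem exponentNoisy_le {d n : ℕ} {ρ P t : ℝ} (hP : 0 < P) (ht : 0 < t) (hn : 2 ≤ n)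
    (δ c h ε k : ℝ) :
    exponentNoisy d ρ P t δ c h ε n k ≤ exponentNoisy d ρ P t δ c h ε n (optimalK d ρ P t n) := by
  by_cases hk : k = optimalK d ρ P t n
  · rw [hk]
  · exact min_le_min_right _ (exponentNoiseFree_lt hP ht hn hk).le

theorem half_sum_exp_noisy_le {d n : ℕ} {ρ P t : ℝ} (ht : 0 < t) (htP : t ≤ P) (hn : 2 ≤ n) {k : ℝ}
    (hk : |k - optimalK d ρ P t n| < 1) (m : ℕ) (δ c h ε : ℝ) :
    (m * Real.exp (-isolationExponent ρ n k) + 2 * m * Real.exp (-connectionExponent d P t k)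
        + 2 * Real.exp (-(n * (δ / 8))) + 3 * Real.exp (-(n * (c * h ^ d * ε ^ 2)))) / 2
      ≤ (3 * m + 5) * Real.exp (-(((n : ℝ) - 1) * rateNoisy d ρ P t δ c h ε n)) := by
  have hopt := exponentNoisy_optimalK (d := d) (ρ := ρ) (ht.trans_le htP) ht hn δ c h ε
  rw [exponentNoisy, exponentNoiseFree_optimalK (ht.trans_le htP) ht hn] at hopt
  have h0 := half_sum_exp_le ht htP hn hk m
  have h1 : Real.exp (-(((n : ℝ) - 1) * rateNoiseFree d ρ P t)) ≤
      Real.exp (-(((n : ℝ) - 1) * rateNoisy d ρ P t δ c h ε n)) := by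
    rw [Real.exp_le_exp, neg_le_neg_iff, ← hopt]
    exact min_le_left _ _
  have h2 : Real.exp (-(n * (δ / 8))) ≤
      Real.exp (-(((n : ℝ) - 1) * rateNoisy d ρ P t δ c h ε n)) := by
    rw [Real.exp_le_exp, neg_le_neg_iff, ← hopt]
    exact (min_le_right _ _).trans (min_le_left _ _)
  have h3 : Real.exp (-(n * (c * h ^ d * ε ^ 2))) ≤
      Real.exp (-(((n : ℝ) - 1) * rateNoisy d ρ P t δ c h ε n)) := by
    rw [Real.exp_le_exp, neg_le_neg_iff, ← hopt]
    exact (min_le_right _ _).trans (min_le_right _ _)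
  have h4 := mul_le_mul_of_nonneg_left h1 (by positivity : (0 : ℝ) ≤ 3 * m)
  have h5 := Real.exp_pos (-(((n : ℝ) - 1) * rateNoisy d ρ P t δ c h ε n))
  linarith

/-- The guarantee in the noisy case, with half of the stated failure probability. -/
theorem eventually_le_roughlyIdentified {d m : ℕ} (hd : 0 < d) {p : Pt d → ℝ}
    (hp : IsBoundedDensity p) (hpc : Continuous p) {K : Pt d → ℝ} {t : ℝ} {C : Fin m → Set (Pt d)}
    {u ρ : Fin m → ℝ} {ε₀ ε δ h c : ℝ} (ht : 0 < t) (hC : IsClusters p t C) (hε₀ : 0 < ε₀)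
    (hsep : IsSeparated p (fun i => enlarge p t (2 * ε₀) (C i)) u ρ) (hε : 0 < ε) (hεε₀ : ε ≤ ε₀)
    (hcov : levelSet p (t - 2 * ε) ⊆ ⋃ i, enlarge p t (2 * ε) (C i)) (hδ : 0 < δ)
    (hcond : Condition2 p t C ε δ)
    (hkde : ∀ᶠ n : ℕ in atTop,
      (sampleLaw p n).real {x | ¬ ∀ a, |kde K h x (x a) - p (x a)| < ε} ≤
        3 * Real.exp (-(n * (c * h ^ d * ε ^ 2))) / 2) :
    ∀ᶠ n : ℕ in atTop, ∀ k : ℕ,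
      (∀ i, Condition1 p t (C i) (enlarge p t (2 * ε₀) (C i)) (u i) (ρ i) n k) →
      1 - (m * Real.exp (-isolationExponent (⨅ i, ρ i) n k)
          + 2 * m * Real.exp (-connectionExponent d (⨆ i, maxDensity p (C i)) t k)
          + 2 * Real.exp (-(n * (δ / 8))) + 3 * Real.exp (-(n * (c * h ^ d * ε ^ 2)))) / 2
        ≤ (sampleLaw p n).real {x | ∀ i,
          IsRoughlyIdentified C x (mutualKNN k x) (tildeVertices K h k (t - ε) δ x) i} := by
  have hbg : MeasurableSet (⋃ i, enlarge p t (2 * ε) (C i) \ C i) :=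
    MeasurableSet.iUnion fun i =>
      ((hC.isClosed_enlarge (by linarith) i).measurableSet).diff (hC.isCompact i).measurableSet
  have htC : ∀ᵐ x, x ∈ levelSet p t → t ≤ p x := ae_of_all _ fun x hx => by
    rwa [levelSet_eq_of_continuous hpc] at hx
  filter_upwards [hkde, eventually_sampleLaw_counts_le hp
      (fun i => (hC.isCompact i).measurableSet) hbg hδ hcond.1 hcond.2,
    eventually_sampleLaw_not_linked_isolated_le hd hp ht hC
      (fun i => subset_enlarge (by linarith) (hC.subset_levelSet i))
      (fun i => hC.isClosed_enlarge (by linarith) i) hsep htC] with n h1 h2 h3 k hk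
  have := isProbabilityMeasure_sampleLaw hp n
  refine one_sub_measureReal_le _ ((measureReal_union_le _ _).trans
    (add_le_add ((measureReal_union_le _ _).trans (add_le_add (h3 k hk) h2)) h1)
    |>.trans (by linarith)) ?_
  intro x hx i
  simp only [compl_union, mem_inter_iff, mem_compl_iff, mem_ofPred_eq, not_not] at hx
  exact isRoughlyIdentified_of_linked_isolated hpc hC hε₀ hsep hεε₀ hcov hx.1.1 hx.2
    hx.1.2.1 hx.1.2.2 i

/-- The guarantee in the noise-free case, with half of the stated failure probability. -/
theorem eventually_le_identified {d m : ℕ} (hd : 0 < d) {p : Pt d → ℝ}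
    (hp : IsBoundedDensity p) {t : ℝ} {C : Fin m → Set (Pt d)} {u ρ : Fin m → ℝ} (ht : 0 < t)
    (hC : IsClusters p t C) (hnf : IsNoiseFree p t) (hsep : IsSeparated p C u ρ) :
    ∀ᶠ n : ℕ in atTop, ∀ k : ℕ, (∀ i, Condition1 p t (C i) (C i) (u i) (ρ i) n k) →
      1 - (m * Real.exp (-isolationExponent (⨅ i, ρ i) n k)
          + 2 * m * Real.exp (-connectionExponent d (⨆ i, maxDensity p (C i)) t k)) / 2
        ≤ (sampleLaw p n).real {x | ∀ i, IsIdentified C x (mutualKNN k x) i} := by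
  filter_upwards [eventually_sampleLaw_not_linked_isolated_le hd hp ht hC (fun _ => subset_rfl)
    (fun i => (hC.isCompact i).isClosed) hsep (hnf.mono fun _ h => h.1)] with n hn k hk
  have := isProbabilityMeasure_sampleLaw hp n
  refine one_sub_measureReal_le _ ((measureReal_union_le _ _).trans
    (add_le_add (hn k hk) (sampleLaw_exists_notMem_levelSet hp hnf n).le)
    |>.trans (by linarith)) ?_
  intro x hx i
  simp only [compl_union, mem_inter_iff, mem_compl_iff, mem_ofPred_eq, not_not, not_exists] at hx
  exact isIdentified_of_linked_isolated hsep (fun a => hC.exists_mem (hx.2 a)) hx.1 i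

theorem le_iSup_maxDensity {d m : ℕ} (hd : 0 < d) {p : Pt d → ℝ} (hp : IsBoundedDensity p) {t : ℝ}
    {C : Fin m → Set (Pt d)} (hm : 0 < m) (hC : IsClusters p t C)
    (htC : ∀ᵐ x, x ∈ levelSet p t → t ≤ p x) : t ≤ ⨆ i, maxDensity p (C i) := by
  let i : Fin m := ⟨0, hm⟩
  refine le_trans (le_maxDensity_of_ae hp (volume_real_pos_of_curvatureRadius_pos hd
    (hC.isCompact i) (hC.isConnected i).nonempty (hC.curvatureRadius_pos i)) ?_)
    (le_ciSup (f := fun i => maxDensity p (C i)) (finite_range _).bddAbove i)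
  filter_upwards [htC] with x hx hxC using hx (hC.subset_levelSet i hxC)

end KNNCluster

open KNNCluster MeasureTheory in
theorem theorem3 {d : ℕ} (hd : 0 < d) (p : Pt d → ℝ) (hp : IsBoundedDensity p) :
    -- the noise-free case
    (∀ (t : ℝ) (m : ℕ) (C : Fin m → Set (Pt d)) (u ρ : Fin m → ℝ),
      0 < t → 0 < m → IsClusters p t C → IsNoiseFree p t → IsSeparated p C u ρ →
      ∀ ρmin pmax : ℝ, ρmin = (⨅ i, ρ i) → pmax = (⨆ i, maxDensity p (C i)) →
      ∃ N : ℕ, ∀ n : ℕ, N ≤ n →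
        -- the guarantee for an arbitrary admissible number of neighbors
        (∀ k : ℕ, (∀ i, Condition1 p t (C i) (C i) (u i) (ρ i) n k) →
          1 - (m * Real.exp (-isolationExponent ρmin n k)
              + 2 * m * Real.exp (-connectionExponent d pmax t k))
            ≤ (sampleLaw p n).real {x | ∀ i, IsIdentified C x (mutualKNN k x) i}) ∧
        -- the unique choice with the best exponent
        (∀ k : ℝ, k ≠ optimalK d ρmin pmax t n →
          exponentNoiseFree d ρmin pmax t n k
            < exponentNoiseFree d ρmin pmax t n (optimalK d ρmin pmax t n)) ∧
        exponentNoiseFree d ρmin pmax t n (optimalK d ρmin pmax t n)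
          = ((n : ℝ) - 1) * rateNoiseFree d ρmin pmax t ∧
        -- the guarantee for that choice, rounded to an integer
        (∀ k : ℕ, |(k : ℝ) - optimalK d ρmin pmax t n| < 1 →
          (∀ i, Condition1 p t (C i) (C i) (u i) (ρ i) n k) →
          1 - 3 * m * Real.exp (-(((n : ℝ) - 1) * rateNoiseFree d ρmin pmax t))
            ≤ (sampleLaw p n).real {x | ∀ i, IsIdentified C x (mutualKNN k x) i})) ∧
    -- the noisy case
    (∀ K : Pt d → ℝ, IsKernel K → IsC3Bounded p →
      ∃ C₁ C₂ : ℝ, 0 < C₁ ∧ 0 < C₂ ∧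
      ∀ (t : ℝ) (m : ℕ) (C : Fin m → Set (Pt d)) (u ρ : Fin m → ℝ) (ε₀ ε δ h : ℝ),
      0 < t → 0 < m → IsClusters p t C →
      0 < ε₀ → IsSeparated p (fun i => enlarge p t (2 * ε₀) (C i)) u ρ →
      0 < ε → ε ≤ ε₀ → levelSet p (t - 2 * ε) ⊆ (⋃ i, enlarge p t (2 * ε) (C i)) →
      0 < δ → Condition2 p t C ε δ → 0 < h → h ^ 2 ≤ C₁ * ε →
      ∀ ρmin pmax : ℝ, ρmin = (⨅ i, ρ i) → pmax = (⨆ i, maxDensity p (C i)) →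
      ∃ N : ℕ, ∀ n : ℕ, N ≤ n →
        -- the guarantee for an arbitrary admissible number of neighbors
        (∀ k : ℕ,
          (∀ i, Condition1 p t (C i) (enlarge p t (2 * ε₀) (C i)) (u i) (ρ i) n k) →
          1 - (m * Real.exp (-isolationExponent ρmin n k)
              + 2 * m * Real.exp (-connectionExponent d pmax t k)
              + 2 * Real.exp (-(n * (δ / 8)))
              + 3 * Real.exp (-(n * (C₂ * h ^ d * ε ^ 2))))
            ≤ (sampleLaw p n).real {x | ∀ i,
                IsRoughlyIdentified C x (mutualKNN k x) (tildeVertices K h k (t - ε) δ x) i}) ∧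
        -- the choice with the best exponent
        (∀ k : ℝ, exponentNoisy d ρmin pmax t δ C₂ h ε n k
            ≤ exponentNoisy d ρmin pmax t δ C₂ h ε n (optimalK d ρmin pmax t n)) ∧
        exponentNoisy d ρmin pmax t δ C₂ h ε n (optimalK d ρmin pmax t n)
          = ((n : ℝ) - 1) * rateNoisy d ρmin pmax t δ C₂ h ε n ∧
        -- the guarantee for that choice, rounded to an integer
        (∀ k : ℕ, |(k : ℝ) - optimalK d ρmin pmax t n| < 1 →
          (∀ i, Condition1 p t (C i) (enlarge p t (2 * ε₀) (C i)) (u i) (ρ i) n k) →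
          1 - (3 * m + 5) * Real.exp (-(((n : ℝ) - 1) * rateNoisy d ρmin pmax t δ C₂ h ε n))
            ≤ (sampleLaw p n).real {x | ∀ i,
                IsRoughlyIdentified C x (mutualKNN k x) (tildeVertices K h k (t - ε) δ x) i})) := by
  refine ⟨?_, ?_⟩
  · intro t m C u ρ ht hm hC hnf hsep ρmin pmax hρ hP
    have htP : t ≤ pmax := hP ▸ le_iSup_maxDensity hd hp hm hC (hnf.mono fun _ h => h.1)
    have hP0 : 0 < pmax := ht.trans_le htP
    obtain ⟨N, hN⟩ := Filter.eventually_atTop.1 (eventually_le_identified hd hp ht hC hnf hsep)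
    refine ⟨max N 2, fun n hn => ?_⟩
    have hn2 : 2 ≤ n := (le_max_right _ _).trans hn
    have hmain := hN n ((le_max_left _ _).trans hn)
    rw [← hρ, ← hP] at hmain
    refine ⟨fun k hk => le_trans ?_ (hmain k hk), fun k hk => exponentNoiseFree_lt hP0 ht hn2 hk,
      exponentNoiseFree_optimalK hP0 ht hn2, fun k hk hk' => le_trans ?_ (hmain k hk')⟩
    · have : 0 ≤ (m * Real.exp (-isolationExponent ρmin n k)
          + 2 * m * Real.exp (-connectionExponent d pmax t k)) := by positivity
      linarith
    · linarith [half_sum_exp_le ht htP hn2 hk m]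
  · intro K hK hp3
    have hpc : Continuous p := hp3.1.continuous
    obtain ⟨P, hP0, hP⟩ : ∃ P : ℝ, 0 < P ∧ ∀ x, p x ≤ P := by
      obtain ⟨P, hP⟩ := hp.bounded
      exact ⟨max P 1, by positivity, fun x => (hP x).trans (le_max_left _ _)⟩
    obtain ⟨C₁, C₂, hC₁, hC₂, hkde⟩ := exists_kde_concentration hp hK hp3 hP0 hP
    refine ⟨C₁, C₂, hC₁, hC₂, ?_⟩
    intro t m C u ρ ε₀ ε δ h ht hm hC hε₀ hsep hε hεε₀ hcov hδ hcond hh hhε ρmin pmax hρ hPm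
    have htP : t ≤ pmax := hPm ▸ le_iSup_maxDensity hd hp hm hC
      (ae_of_all _ fun x hx => by rwa [levelSet_eq_of_continuous hpc] at hx)
    have hP0' : 0 < pmax := ht.trans_le htP
    have hεP : ε ≤ P := by
      let i : Fin m := ⟨0, hm⟩
      have h1 := lt_of_isSeparated_enlarge hd hp hC (by linarith) hsep i
      obtain ⟨x, hx⟩ := (hC.isConnected i).nonempty
      have h2 := hC.subset_levelSet i hx
      rw [levelSet_eq_of_continuous hpc] at h2
      have h3 : t ≤ p x := h2
      linarith [hP x]
    obtain ⟨N, hN⟩ := Filter.eventually_atTop.1 (eventually_le_roughlyIdentified hd hp hpc ht hC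
      hε₀ hsep hε hεε₀ hcov hδ hcond (hkde ε h hε hεP hh hhε))
    refine ⟨max N 2, fun n hn => ?_⟩
    have hn2 : 2 ≤ n := (le_max_right _ _).trans hn
    have hmain := hN n ((le_max_left _ _).trans hn)
    rw [← hρ, ← hPm] at hmain
    refine ⟨fun k hk => le_trans ?_ (hmain k hk), exponentNoisy_le hP0' ht hn2 δ C₂ h ε,
      exponentNoisy_optimalK hP0' ht hn2 δ C₂ h ε, fun k hk hk' => le_trans ?_ (hmain k hk')⟩
    · have : 0 ≤ (m * Real.exp (-isolationExponent ρmin n k)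
          + 2 * m * Real.exp (-connectionExponent d pmax t k)
          + 2 * Real.exp (-(n * (δ / 8))) + 3 * Real.exp (-(n * (C₂ * h ^ d * ε ^ 2)))) := by
        positivity
      linarith
    · linarith [half_sum_exp_noisy_le ht htP hn2 hk m δ C₂ h ε]
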